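/- For a probability measure $\eta$ on $\mathbb R$ let $F_\eta(x)=\eta((-\infty,x])$ and $F_\eta^{-1}(u)=\inf\{x\in\mathbb R: F_\eta(x)\ge u\}$, $u\in(0,1)$. Let $\mathcal P_1(\mathbb R)$ be the set of probability measures on $\mathbb R$ with finite first moment, and write $\mu\le_{cx}\nu$ if $\int f\,d\mu\le\int f\,d\nu$ for every convex $f:\mathbb R\to\mathbb R$. Let $\Pi(\mu,\nu)$ be the set of measures on $\mathbb R\times\mathbb R$ with first marginal $\mu$ and second marginal $\nu$; for $\pi\in\Pi(\mu,\nu)$ write $\pi(dx,dy)=\mu(dx)\,\pi_x(dy)$. Let $\Pi^{\mathrm M}(\mu,\nu)$ be the set of $M\in\Pi(\mu,\nu)$ such that $\int y\,M_x(dy)=x$ for $\mu$-almost every $x$. Let $\mathcal W_1(p,q)=\inf_{\gamma\in\Pi(p,q)}\int|y-y'|\,\gamma(dy,dy')$ and, for $\pi\in\Pi(\mu,\nu)$, $\pi'\in\Pi(\mu',\nu')$, $$\mathcal{AW}_1(\pi,\pi')=\inf_{\chi\in\Pi(\mu,\mu')}\int\big(|x-x'|+\mathcal W_1(\pi_x,\pi'_{x'})\big)\,\chi(dx,dx').$$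 A coupling $M\in\Pi^{\mathrm M}(\mu,\nu)$ is called a martingale rearrangement coupling of $\pi\in\Pi(\mu,\nu)$ if $\mathcal{AW}_1(\pi,M)=\inf_{M'\in\Pi^{\mathrm M}(\mu,\nu)}\mathcal{AW}_1(\pi,M')$. The Hoeffding–Fréchet coupling $\pi^{HF}$ of $\mu$ and $\nu$ is the image of the Lebesgue measure on $(0,1)$ by $u\mapsto(F_\mu^{-1}(u),F_\nu^{-1}(u))$. Let $\mu,\nu\in\mathcal P_1(\mathbb R)$ with $\mu\le_{cx}\nu$. For $u\in[0,1]$ let $\Psi_\pm(u)=\int_0^u(F_\mu^{-1}-F_\nu^{-1})^\pm(v)\,dv$, and let $\Psi_\pm^{-1}(t)=\inf\{r\in[0,1]:\Psi_\pm(r)\ge t\}$. Let $\mathcal Q$ be the set of probability measures $Q$ on $(0,1)^2$ such that $u<v$ for $Q$-almost every $(u,v)$ and such that the first and second marginals of $Q$, multiplied by $\Psi_+(1)$, are $d\Psi_+$ and $d\Psi_-$ respectively (if $\mu\ne\nu$ then $\Psi_+(1)>0$ and the marginals are $\frac{1}{\Psi_+(1)}d\Psi_+$ and $\frac1{\Psi_+(1)}d\Psi_-$;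 if $\mu=\nu$ the condition on the marginals is void). For $Q\in\mathcal Q$ let $\pi^Q_u(dv)$ denote the conditional law under $Q$ of the second coordinate given that the first one is $u$ if $F_\mu^{-1}(u)>F_\nu^{-1}(u)$, and of the first coordinate given that the second one is $u$ if $F_\mu^{-1}(u)<F_\nu^{-1}(u)$. For such $u$ let $$\widetilde m^Q_u(dy)=\int\left(\frac{F_\mu^{-1}(u)-F_\nu^{-1}(u)}{F_\nu^{-1}(v)-F_\nu^{-1}(u)}\,\delta_{F_\nu^{-1}(v)}(dy)+\frac{F_\nu^{-1}(v)-F_\mu^{-1}(u)}{F_\nu^{-1}(v)-F_\nu^{-1}(u)}\,\delta_{F_\nu^{-1}(u)}(dy)\right)\pi^Q_u(dv),$$ let $\widetilde m^Q_u=\delta_{F_\nu^{-1}(u)}$ if $F_\mu^{-1}(u)=F_\nu^{-1}(u)$, and let $$M^Q(dx,dy)=\int_0^1\delta_{F_\mu^{-1}(u)}(dx)\,\widetilde m^Q_u(dy)\,du .$$ Let $\varphi(u)$ be $\Psi_-^{-1}(\Psi_+(u))$, $\Psi_+^{-1}(\Psi_-(u))$ or $u$ according to whether $F_\mu^{-1}(u)$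 is greater than, less than or equal to $F_\nu^{-1}(u)$, and let $Q^{IT}(du,dv)=\frac1{\Psi_+(1)}\,d\Psi_+(u)\,\mathbf 1_{\{0<\varphi(u)<1\}}\,\delta_{\varphi(u)}(dv)$ (the zero measure if $\mu=\nu$). The inverse transform martingale coupling is $M^{IT}=M^{Q^{IT}}$, given by the same formulas. **Proposition.** For all $\mu,\nu\in\mathcal P_1(\mathbb R)$ with $\mu\le_{cx}\nu$ there exists $Q\in\mathcal Q$ such that 1. $M^Q$ is a martingale coupling between $\mu$ and $\nu$ and is a martingale rearrangement coupling of $\pi^{HF}$, that is, $\mathcal{AW}_1(\pi^{HF},M^Q)=\inf_{M\in\Pi^{\mathrm M}(\mu,\nu)}\mathcal{AW}_1(\pi^{HF},M)$; 2. if, for every $x\in\mathbb R$, the function $u\mapsto F_\mu^{-1}(u)-F_\nu^{-1}(u)$ is either nonnegative throughout or nonpositive throughout $(F_\mu(x-),F_\mu(x)]\cap(0,1)$, then $M^Q=M^{IT}$. -/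

import Mathlib

open MeasureTheory Set
open scoped ENNReal

namespace MartRearr

/-! ### Couplings, disintegration, adapted Wasserstein distance -/

/-- A finite first moment (for a probability measure: membership in `𝒫₁(ℝ)`). -/
def FiniteFirstMoment (μ : Measure ℝ) : Prop :=
  Integrable (fun x : ℝ => x) μ

/-- The convex order `μ ≤_cx ν` for measures with finite first moments. A convex function that is
not integrable has integral `+∞`, and the requirement on it follows from the one on the integrable
convex functions (approximate from below by convex Lipschitz functions). -/
def ConvexOrder (μ ν : Measure ℝ) : Prop :=
  ∀ f : ℝ → ℝ, ConvexOn ℝ univ f → Integrable f μ → Integrable f ν →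
    ∫ x, f x ∂μ ≤ ∫ x, f x ∂ν

/-- `π ∈ Π(p, q)`: the first marginal of `π` is `p`, the second one is `q`. -/
def IsCoupling (p q : Measure ℝ) (π : Measure (ℝ × ℝ)) : Prop :=
  π.fst = p ∧ π.snd = q

open Classical in
/-- The disintegration `π_x(dy)` of a finite measure `π(dx, dy)` with respect to its first marginal
(a probability kernel, determined for `π.fst`-almost every `x`). -/
noncomputable def condLaw (π : Measure (ℝ × ℝ)) (x : ℝ) : Measure ℝ :=
  if _h : IsFiniteMeasure π then π.condKernel x else 0

/-- `M ∈ Π^M(μ, ν)`: a martingale coupling. -/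
def IsMartingaleCoupling (μ ν : Measure ℝ) (M : Measure (ℝ × ℝ)) : Prop :=
  IsCoupling μ ν M ∧ ∀ᵐ x ∂μ, ∫ y, y ∂(condLaw M x) = x

/-- The Wasserstein distance `𝒲₁`. -/
noncomputable def W1 (p q : Measure ℝ) : ℝ≥0∞ :=
  ⨅ (γ : Measure (ℝ × ℝ)) (_ : IsCoupling p q γ), ∫⁻ z, edist z.1 z.2 ∂γ

/-- The adapted Wasserstein distance `𝒜𝒲₁`. -/
noncomputable def AW1 (π π' : Measure (ℝ × ℝ)) : ℝ≥0∞ :=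
  ⨅ (χ : Measure (ℝ × ℝ)) (_ : IsCoupling π.fst π'.fst χ),
    ∫⁻ z, (edist z.1 z.2 + W1 (condLaw π z.1) (condLaw π' z.2)) ∂χ

/-- `M` is a martingale rearrangement coupling of the coupling `π` between `μ` and `ν`. -/
def IsMartingaleRearrangement (μ ν : Measure ℝ) (π M : Measure (ℝ × ℝ)) : Prop :=
  IsMartingaleCoupling μ ν M ∧
    AW1 π M = ⨅ (M' : Measure (ℝ × ℝ)) (_ : IsMartingaleCoupling μ ν M'), AW1 π M'

/-! ### Quantile functions and the comonotone coupling -/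

/-- The quantile function `F_η⁻¹(u) = inf {x | F_η(x) ≥ u}`, used for `u ∈ (0,1)`. -/
noncomputable def quantile (η : Measure ℝ) (u : ℝ) : ℝ :=
  sInf {x : ℝ | u ≤ ProbabilityTheory.cdf η x}

/-- The Lebesgue measure on `(0,1)`. -/
noncomputable def unitLebesgue : Measure ℝ :=
  volume.restrict (Ioo 0 1)

/-- The Hoeffding–Fréchet coupling `π^HF`. -/
noncomputable def hoeffdingFrechet (μ ν : Measure ℝ) : Measure (ℝ × ℝ) :=
  unitLebesgue.map (fun u => (quantile μ u, quantile ν u))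

/-! ### The family `𝒬` and the couplings `M^Q` -/

/-- `Ψ₊(u) = ∫₀ᵘ (F_μ⁻¹ - F_ν⁻¹)⁺(v) dv`. -/
noncomputable def psiPlus (μ ν : Measure ℝ) (u : ℝ) : ℝ :=
  ∫ v in (0 : ℝ)..u, max (quantile μ v - quantile ν v) 0

/-- `Ψ₋(u) = ∫₀ᵘ (F_μ⁻¹ - F_ν⁻¹)⁻(v) dv`. -/
noncomputable def psiMinus (μ ν : Measure ℝ) (u : ℝ) : ℝ :=
  ∫ v in (0 : ℝ)..u, max (quantile ν v - quantile μ v) 0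

/-- The measure `dΨ₊` on `(0,1)`. -/
noncomputable def dPsiPlus (μ ν : Measure ℝ) : Measure ℝ :=
  unitLebesgue.withDensity (fun v => ENNReal.ofReal (max (quantile μ v - quantile ν v) 0))

/-- The measure `dΨ₋` on `(0,1)`. -/
noncomputable def dPsiMinus (μ ν : Measure ℝ) : Measure ℝ :=
  unitLebesgue.withDensity (fun v => ENNReal.ofReal (max (quantile ν v - quantile μ v) 0))

/-- The set `𝒬` of the probability measures on `(0,1)²` with marginals `dΨ₊ / Ψ₊(1)` and
`dΨ₋ / Ψ₊(1)` that are concentrated on `{u < v}`. The marginal conditions are multiplied by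
`Ψ₊(1)`, which is positive unless `μ = ν`; for `μ = ν` they are void. -/
def QSet (μ ν : Measure ℝ) : Set (Measure (ℝ × ℝ)) :=
  {Q | IsProbabilityMeasure Q ∧
    (∀ᵐ z ∂Q, z.1 ∈ Ioo (0 : ℝ) 1 ∧ z.2 ∈ Ioo (0 : ℝ) 1) ∧
    ENNReal.ofReal (psiPlus μ ν 1) • Q.fst = dPsiPlus μ ν ∧
    ENNReal.ofReal (psiPlus μ ν 1) • Q.snd = dPsiMinus μ ν ∧
    ∀ᵐ z ∂Q, z.1 < z.2}

/-- The law on the two points `F_ν⁻¹(u)`, `F_ν⁻¹(v)` with mean `F_μ⁻¹(u)`. -/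
noncomputable def twoPoint (μ ν : Measure ℝ) (u v : ℝ) : Measure ℝ :=
  ENNReal.ofReal ((quantile μ u - quantile ν u) / (quantile ν v - quantile ν u)) •
      Measure.dirac (quantile ν v) +
    ENNReal.ofReal ((quantile ν v - quantile μ u) / (quantile ν v - quantile ν u)) •
      Measure.dirac (quantile ν u)

/-- The kernel `m̃^Q_u`. The kernel `π^Q_u` is the disintegration of `Q` with respect to its first
marginal where `F_μ⁻¹(u) > F_ν⁻¹(u)`, and with respect to its second marginal where
`F_μ⁻¹(u) < F_ν⁻¹(u)`. -/
noncomputable def mTilde (μ ν : Measure ℝ) (Q : Measure (ℝ × ℝ)) (u : ℝ) : Measure ℝ :=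
  if quantile ν u < quantile μ u then
    (condLaw Q u).bind (twoPoint μ ν u)
  else if quantile μ u < quantile ν u then
    (condLaw (Q.map Prod.swap) u).bind (twoPoint μ ν u)
  else Measure.dirac (quantile ν u)

/-- `M^Q(dx, dy) = ∫₀¹ δ_{F_μ⁻¹(u)}(dx) m̃^Q_u(dy) du`. -/
noncomputable def MQ (μ ν : Measure ℝ) (Q : Measure (ℝ × ℝ)) : Measure (ℝ × ℝ) :=
  unitLebesgue.bind (fun u => (mTilde μ ν Q u).map (fun y => (quantile μ u, y)))

/-! ### The inverse transform martingale coupling -/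

/-- The left-continuous generalised inverse on `[0,1]`. -/
noncomputable def genInv (Ψ : ℝ → ℝ) (t : ℝ) : ℝ :=
  sInf {r : ℝ | r ∈ Icc (0 : ℝ) 1 ∧ t ≤ Ψ r}

/-- The map `φ`. -/
noncomputable def phi (μ ν : Measure ℝ) (u : ℝ) : ℝ :=
  if quantile ν u < quantile μ u then genInv (psiMinus μ ν) (psiPlus μ ν u)
  else if quantile μ u < quantile ν u then genInv (psiPlus μ ν) (psiMinus μ ν u)
  else u

/-- `Q^IT(du, dv) = (1 / Ψ₊(1)) dΨ₊(u) 1_{0 < φ(u) < 1} δ_{φ(u)}(dv)`. -/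
noncomputable def QIT (μ ν : Measure ℝ) : Measure (ℝ × ℝ) :=
  ENNReal.ofReal (1 / psiPlus μ ν 1) •
    ((dPsiPlus μ ν).restrict {u | phi μ ν u ∈ Ioo (0 : ℝ) 1}).map (fun u => (u, phi μ ν u))

/-- The inverse transform martingale coupling `M^IT = M^{Q^IT}`. -/
noncomputable def MIT (μ ν : Measure ℝ) : Measure (ℝ × ℝ) :=
  MQ μ ν (QIT μ ν)

/-- On each jump `(F_μ(x-), F_μ(x)]` of `F_μ`, the sign of `F_μ⁻¹ - F_ν⁻¹` is constant: this
difference is nonnegative throughout or nonpositive throughout. -/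
def SignConstantOnJumps (μ ν : Measure ℝ) : Prop :=
  ∀ x : ℝ,
    (∀ u ∈ Ioc (Function.leftLim (ProbabilityTheory.cdf μ) x) (ProbabilityTheory.cdf μ x),
      u < 1 → quantile ν u ≤ quantile μ u) ∨
    (∀ u ∈ Ioc (Function.leftLim (ProbabilityTheory.cdf μ) x) (ProbabilityTheory.cdf μ x),
      u < 1 → quantile μ u ≤ quantile ν u)

end MartRearr

namespace MartRearr

open ProbabilityTheory Filter Topology

/-! Every martingale coupling `M` of `μ` and `ν` satisfies `AW1 π M ≥ ∫ |x - ∫ y π_x(dy)| μ(dx)`: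
`W1` dominates the distance between means, the mean of `M_{x'}` is `x'`, and the triangle inequality
removes `x'`. The bound does not depend on `M`. It is attained, by the diagonal coupling of `μ` with
itself, as soon as `M_x` and `π_x` are stochastically ordered for almost every `x`, because `W1` of
two ordered laws is the distance between their means. It remains to choose `Q` so that `M^Q_x` and
`π^HF_x` are ordered.

Up to normalisation, `M^Q` arises from `π^HF` by exchanges. For a pair `(u, v)` charged by `Q`, mass
at `F_ν⁻¹(u)` above `F_μ⁻¹(u)` moves up to `F_ν⁻¹(v)`, and an equal mass at `F_ν⁻¹(v)` above
`F_μ⁻¹(v)` moves down to `F_ν⁻¹(u)`. If `u` and `v` lie in the same fibre of `F_μ⁻¹`, that is, in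
the same jump of `F_μ`, the two moves cancel in `M_x`. So `dΨ₊` and `dΨ₋` are first coupled inside
the fibres as far as their masses allow. What then remains has only one sign on each fibre, so
outside the cancelling pairs mass over a given `x` moves only up or only down (`MQ_prod_Iic_le`,
`prod_Iic_le_MQ`).

The residuals are coupled by monotone transport. The convex order gives `dΨ₋ ≤ dΨ₊` on lower sets;
this survives for the residuals (`residual_Iic_le`) and forces `u < v` (`ae_le_transportMap`). If
the sign is constant on jumps, nothing is coupled inside the fibres and the monotone transport of
`dΨ₊` to `dΨ₋` is `φ`, hence `M^Q = M^IT`. -/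

instance : IsProbabilityMeasure unitLebesgue := by
  refine ⟨?_⟩
  simp [unitLebesgue]

/-! ### Quantile functions. -/

section Quantile

variable (η : Measure ℝ)

lemma quantile_set_nonempty {u : ℝ} (hu : u < 1) : {x : ℝ | u ≤ cdf η x}.Nonempty := by
  obtain ⟨x, hx⟩ := ((tendsto_cdf_atTop η).eventually (lt_mem_nhds hu)).exists
  exact ⟨x, hx.le⟩

lemma quantile_set_bddBelow {u : ℝ} (hu : 0 < u) : BddBelow {x : ℝ | u ≤ cdf η x} := by
  obtain ⟨x, hx⟩ := ((tendsto_cdf_atBot η).eventually (gt_mem_nhds hu)).exists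
  refine ⟨x, fun y hy => ?_⟩
  by_contra! h
  exact absurd (monotone_cdf η h.le) (not_le.2 (lt_of_lt_of_le hx hy))

/-- Right continuity of the distribution function makes the infimum attained. -/
lemma quantile_le_iff {u : ℝ} (hu : u ∈ Ioo (0 : ℝ) 1) (x : ℝ) :
    quantile η u ≤ x ↔ u ≤ cdf η x := by
  refine ⟨fun h => ?_, fun h => csInf_le (quantile_set_bddBelow η hu.1) h⟩
  have key : ∀ y, x < y → u ≤ cdf η y := by
    intro y hy
    obtain ⟨z, hz, hzy⟩ := exists_lt_of_csInf_lt (quantile_set_nonempty η hu.2)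
      (lt_of_le_of_lt h hy)
    exact le_trans hz (monotone_cdf η hzy.le)
  have hc : Tendsto (cdf η) (𝓝[>] x) (𝓝 (cdf η x)) :=
    ((cdf η).right_continuous x).tendsto.mono_left (nhdsWithin_mono _ Ioi_subset_Ici_self)
  exact ge_of_tendsto hc (eventually_nhdsWithin_of_forall key)

lemma quantile_mono {u v : ℝ} (hu : u ∈ Ioo (0 : ℝ) 1) (hv : v ∈ Ioo (0 : ℝ) 1) (h : u ≤ v) :
    quantile η u ≤ quantile η v :=
  (quantile_le_iff η hu _).2 (h.trans ((quantile_le_iff η hv _).1 le_rfl))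

lemma quantile_of_nonpos {u : ℝ} (hu : u ≤ 0) : quantile η u = 0 := by
  have : {x : ℝ | u ≤ cdf η x} = univ := eq_univ_of_forall fun x => hu.trans (cdf_nonneg η x)
  rw [quantile, this, Real.sInf_univ]

lemma quantile_of_one_lt {u : ℝ} (hu : 1 < u) : quantile η u = 0 := by
  have : {x : ℝ | u ≤ cdf η x} = ∅ :=
    eq_empty_of_forall_notMem fun x hx => absurd (le_trans hx (cdf_le_one η x)) (not_le.2 hu)
  rw [quantile, this, Real.sInf_empty]

@[fun_prop]
lemma measurable_quantile : Measurable (quantile η) := by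
  have h1 : Measurable ((Ioo (0 : ℝ) 1).domRestrict (quantile η)) :=
    Monotone.measurable fun u v h => quantile_mono η u.2 v.2 h
  -- Off `(0,1)` the infimum is over `univ` or `∅`, with default value `0`, except at the single
  -- point `1`.
  have h2 : Measurable ((Ioo (0 : ℝ) 1)ᶜ.domRestrict (quantile η)) := by
    have : (Ioo (0 : ℝ) 1)ᶜ.domRestrict (quantile η)
        = fun u : ((Ioo (0 : ℝ) 1)ᶜ : Set ℝ) => if (u : ℝ) ∈ ({1} : Set ℝ) then quantile η 1 else 0 := by
      funext u
      simp only [domRestrict_apply, mem_singleton_iff]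
      split_ifs with h
      · rw [h]
      · rcases le_or_gt (u : ℝ) 0 with h0 | h0
        · exact quantile_of_nonpos η h0
        · rcases lt_or_ge 1 (u : ℝ) with h1 | h1
          · exact quantile_of_one_lt η h1
          · exact absurd ⟨h0, lt_of_le_of_ne h1 h⟩ u.2
    rw [this]
    exact Measurable.ite (measurable_subtype_coe (measurableSet_singleton _))
      measurable_const measurable_const
  exact measurable_of_restrict_of_restrict_compl measurableSet_Ioo h1 h2

lemma ae_mem_Ioo : ∀ᵐ u ∂unitLebesgue, u ∈ Ioo (0 : ℝ) 1 :=
  ae_restrict_mem measurableSet_Ioo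

lemma map_quantile [IsProbabilityMeasure η] : unitLebesgue.map (quantile η) = η := by
  have : IsProbabilityMeasure (unitLebesgue.map (quantile η)) :=
    Measure.isProbabilityMeasure_map (by fun_prop)
  refine Measure.ext_of_Iic _ _ fun x => ?_
  rw [Measure.map_apply (by fun_prop) measurableSet_Iic, ← ofReal_cdf, unitLebesgue,
    Measure.restrict_apply ((measurable_quantile η) measurableSet_Iic)]
  have h : (quantile η ⁻¹' Iic x ∩ Ioo 0 1 : Set ℝ) = Ioc 0 (cdf η x) ∩ Ioo 0 1 := by
    ext u
    constructor
    · rintro ⟨h, hu⟩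
      exact ⟨⟨hu.1, (quantile_le_iff η hu x).1 h⟩, hu⟩
    · rintro ⟨h, hu⟩
      exact ⟨(quantile_le_iff η hu x).2 h.2, hu⟩
  rw [h]
  have h2 : (Ioc 0 (cdf η x) ∩ Ioo 0 1 : Set ℝ) =ᵐ[volume] (Ioc 0 (cdf η x) ∩ Ioc 0 1 : Set ℝ) :=
    (ae_eq_refl _).inter Ioo_ae_eq_Ioc
  rw [measure_congr h2, Ioc_inter_Ioc, Real.volume_Ioc]
  simp [cdf_le_one]

lemma integral_quantile [IsProbabilityMeasure η] (f : ℝ → ℝ) (hf : Measurable f) :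
    ∫ u, f (quantile η u) ∂unitLebesgue = ∫ x, f x ∂η := by
  conv_rhs => rw [← map_quantile η]
  rw [integral_map (by fun_prop) hf.aestronglyMeasurable]

lemma integrable_quantile_comp [IsProbabilityMeasure η] {f : ℝ → ℝ} (hf : Measurable f) (hi : Integrable f η) :
    Integrable (fun u => f (quantile η u)) unitLebesgue := by
  rw [← map_quantile η] at hi
  exact (integrable_map_measure hf.aestronglyMeasurable (by fun_prop)).1 hi

lemma integrable_quantile [IsProbabilityMeasure η] (h : FiniteFirstMoment η) : Integrable (quantile η) unitLebesgue :=
  integrable_quantile_comp η measurable_id h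

end Quantile

/-! ### The convex order in terms of quantiles. -/

section ConvexOrder

variable {μ ν : Measure ℝ} [IsProbabilityMeasure μ] [IsProbabilityMeasure ν]

lemma integral_quantile_eq (hμ : FiniteFirstMoment μ) (hν : FiniteFirstMoment ν)
    (hcx : ConvexOrder μ ν) :
    ∫ u, quantile μ u ∂unitLebesgue = ∫ u, quantile ν u ∂unitLebesgue := by
  have h1 := hcx (fun x => x) (convexOn_id convex_univ) hμ hν
  have h2 := hcx (fun x => -x) ((concaveOn_id convex_univ).neg) hμ.neg hν.neg
  rw [integral_neg, integral_neg] at h2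
  rw [integral_quantile μ (fun x => x) measurable_id, integral_quantile ν (fun x => x) measurable_id]
  linarith

/-- The convex order is tested on `y ↦ (k - y)⁺` with `k` the level of `F_ν⁻¹` at the upper end of
`A`. For `ν` the integral is exactly that of `k - F_ν⁻¹` over `A`; for `μ` it is at least that of `k
- F_μ⁻¹`. -/
lemma setIntegral_quantile_le (hμ : FiniteFirstMoment μ) (hν : FiniteFirstMoment ν)
    (hcx : ConvexOrder μ ν) {A : Set ℝ} (hA : MeasurableSet A)
    (hlow : ∀ u ∈ Ioo (0 : ℝ) 1, ∀ v ∈ A, u ≤ v → u ∈ A) :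
    ∫ u in A, quantile ν u ∂unitLebesgue ≤ ∫ u in A, quantile μ u ∂unitLebesgue := by
  have iμ := integrable_quantile μ hμ
  have iν := integrable_quantile ν hν
  by_cases hfull : Ioo (0 : ℝ) 1 ⊆ A
  · have : unitLebesgue.restrict A = unitLebesgue := by
      rw [unitLebesgue, Measure.restrict_restrict hA, inter_eq_self_of_subset_right hfull]
    rw [this, integral_quantile_eq hμ hν hcx]
  obtain ⟨b, hb, hbA⟩ := not_subset.1 hfull
  by_cases hne : (A ∩ Ioo (0 : ℝ) 1).Nonempty
  swap
  · have : unitLebesgue.restrict A = 0 := by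
      rw [unitLebesgue, Measure.restrict_restrict hA, not_nonempty_iff_eq_empty.1 hne,
        Measure.restrict_empty]
    simp [this]
  -- The level `k` is the supremum of `F_ν⁻¹` over `A ∩ (0,1)`, finite because some point of `(0,1)`
  -- lies above `A`.
  obtain ⟨k, hk1, hk2⟩ : ∃ k, (∀ u ∈ Ioo (0 : ℝ) 1, u ∈ A → quantile ν u ≤ k) ∧
      ∀ u ∈ Ioo (0 : ℝ) 1, u ∉ A → k ≤ quantile ν u := by
    have hub : ∀ v ∈ Ioo (0 : ℝ) 1, v ∉ A →
        ∀ y ∈ quantile ν '' (A ∩ Ioo (0 : ℝ) 1), y ≤ quantile ν v := by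
      rintro v hv hvA _ ⟨u, hu, rfl⟩
      refine quantile_mono ν hu.2 hv ?_
      by_contra! h
      exact hvA (hlow v hv u hu.1 h.le)
    refine ⟨sSup (quantile ν '' (A ∩ Ioo (0 : ℝ) 1)), fun u hu huA => ?_, fun u hu huA => ?_⟩
    · exact le_csSup ⟨_, hub b hb hbA⟩ ⟨u, ⟨huA, hu⟩, rfl⟩
    · exact csSup_le (hne.image _) (hub u hu huA)
  have hmeas : Measurable fun y : ℝ => max (k - y) 0 := by fun_prop
  have hconv : ConvexOn ℝ univ fun y : ℝ => max (k - y) 0 :=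
    ((convexOn_const k convex_univ).sub (concaveOn_id convex_univ)).sup
      (convexOn_const 0 convex_univ)
  have jμ : Integrable (fun y : ℝ => max (k - y) 0) μ :=
    ((integrable_const k).sub hμ).pos_part
  have jν : Integrable (fun y : ℝ => max (k - y) 0) ν :=
    ((integrable_const k).sub hν).pos_part
  have h := hcx _ hconv jμ jν
  rw [← integral_quantile μ _ hmeas, ← integral_quantile ν _ hmeas] at h
  have qμ := integrable_quantile_comp μ hmeas jμ
  have e1 : ∫ u in A, (k - quantile μ u) ∂unitLebesgue
      ≤ ∫ u, max (k - quantile μ u) 0 ∂unitLebesgue :=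
    (integral_mono (((integrable_const k).sub iμ).integrableOn) qμ.integrableOn
      fun u => le_max_left _ _).trans
      (setIntegral_le_integral qμ (ae_of_all _ fun u => le_max_right _ _))
  have e2 : ∫ u, max (k - quantile ν u) 0 ∂unitLebesgue
      = ∫ u in A, (k - quantile ν u) ∂unitLebesgue := by
    rw [← integral_indicator hA]
    refine integral_congr_ae ?_
    filter_upwards [ae_mem_Ioo] with u hu
    by_cases huA : u ∈ A
    · simp [huA, hk1 u hu huA]
    · simp [huA, hk2 u hu huA]
  rw [integral_sub (integrable_const k) iμ.integrableOn] at e1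
  rw [integral_sub (integrable_const k) iν.integrableOn] at e2
  linarith

end ConvexOrder

/-! ### Monotone transport between atomless measures on `(0,1)`. -/

section QuantileCoupling

lemma continuous_real_Iic (α : Measure ℝ) [IsFiniteMeasure α] [NullSingletonClass α] :
    Continuous fun u => α.real (Iic u) := by
  have h : (fun u => α.real (Iic u)) = fun u => α.real (Iic 0) + ∫ _ in (0 : ℝ)..u, (1 : ℝ) ∂α := by
    funext u
    rw [← intervalIntegral.integral_Iic_sub_Iic (integrable_const _).integrableOn
      (integrable_const _).integrableOn]
    simp
  rw [h]
  exact continuous_const.add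
    (intervalIntegral.continuous_primitive (fun _ _ => intervalIntegrable_const) _)

lemma mono_real_Iic (α : Measure ℝ) [IsFiniteMeasure α] : Monotone fun u => α.real (Iic u) :=
  fun _ _ h => measureReal_mono (Iic_subset_Iic.2 h)

lemma real_Iic_eq_zero {α : Measure ℝ} (hα : α (Ioo 0 1)ᶜ = 0) {q : ℝ} (hq : q ≤ 0) :
    α (Iic q) = 0 :=
  measure_mono_null (t := (Ioo 0 1)ᶜ) (fun _ hu h => absurd (h.1.trans_le hu) (not_lt.2 hq)) hα

lemma real_Iic_eq_univ {α : Measure ℝ} (hα : α (Ioo 0 1)ᶜ = 0) {q : ℝ} (hq : 1 ≤ q) :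
    α (Iic q) = α univ := by
  refine measure_congr (ae_eq_univ.2 (measure_mono_null (t := (Ioo 0 1)ᶜ) (fun u hu h => ?_) hα))
  exact hu (h.2.le.trans hq)

variable {α β : Measure ℝ} [IsFiniteMeasure α] [IsFiniteMeasure β]

/-- An atomless distribution function pushes `α` to a uniform law. Inside `(0,1)` the set lies in
`Iic c`, where `c` is the greatest point of `[0,1]` at which the distribution function is at most
`t`; the intermediate value theorem gives the value `t` there. -/
lemma measure_setOf_real_Iic_le {α : Measure ℝ} [IsFiniteMeasure α] [NullSingletonClass α]
    (hα : α (Ioo 0 1)ᶜ = 0) {t : ℝ} (h0 : 0 ≤ t)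
    (h1 : t ≤ α.real univ) : α {u | α.real (Iic u) ≤ t} = ENNReal.ofReal t := by
  have hc := continuous_real_Iic α
  have z0 : α.real (Iic 0) = 0 := by simp [measureReal_def, real_Iic_eq_zero hα le_rfl]
  have z1 : α.real (Iic 1) = α.real univ := by simp [measureReal_def, real_Iic_eq_univ hα le_rfl]
  have hcomp : IsCompact (Icc (0 : ℝ) 1 ∩ {u | α.real (Iic u) ≤ t}) :=
    isCompact_Icc.inter_right (isClosed_le hc continuous_const)
  obtain ⟨c, ⟨hc01, hct⟩, hmax⟩ := hcomp.exists_isGreatest ⟨0, by simp, by simpa [z0] using h0⟩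
  obtain ⟨d, hd, hdt⟩ := intermediate_value_Icc zero_le_one hc.continuousOn
    (show t ∈ Icc (α.real (Iic (0 : ℝ))) (α.real (Iic 1)) by rw [z0, z1]; exact ⟨h0, h1⟩)
  have hdc : d ≤ c := hmax ⟨hd, hdt.le⟩
  have hct' : α.real (Iic c) = t :=
    le_antisymm hct (hdt.symm.le.trans (mono_real_Iic α hdc))
  rw [← hct', ofReal_measureReal]
  refine le_antisymm ?_ (measure_mono fun u hu => mono_real_Iic α hu)
  calc α {u | α.real (Iic u) ≤ α.real (Iic c)} ≤ α (Iic c ∪ (Ioo 0 1)ᶜ) := by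
        refine measure_mono fun u hu => ?_
        by_contra hcon
        rw [mem_union, not_or, notMem_compl_iff] at hcon
        have hu' : α.real (Iic u) ≤ t := le_trans hu hct
        exact hcon.1 (hmax ⟨Ioo_subset_Icc_self hcon.2, hu'⟩)
    _ ≤ α (Iic c) + α (Ioo 0 1)ᶜ := measure_union_le _ _
    _ = α (Iic c) := by rw [hα, add_zero]

lemma genInv_congr {f g : ℝ → ℝ} (h : ∀ r ∈ Icc (0 : ℝ) 1, f r = g r) (t : ℝ) :
    genInv f t = genInv g t := by
  unfold genInv
  congr 1
  ext r
  simp only [mem_ofPred_eq]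
  refine and_congr_right fun hr => ?_
  rw [h r hr]

lemma genInv_mem {f : ℝ → ℝ} (hf : Continuous f) {t : ℝ} (ht : t ≤ f 1) :
    genInv f t ∈ Icc (0 : ℝ) 1 ∧ t ≤ f (genInv f t) := by
  have hcomp : IsCompact (Icc (0 : ℝ) 1 ∩ {u | t ≤ f u}) :=
    isCompact_Icc.inter_right (isClosed_le continuous_const hf)
  exact hcomp.sInf_mem ⟨1, by simp, ht⟩

lemma genInv_le_iff {f : ℝ → ℝ} (hf : Continuous f) (hm : Monotone f) {t q : ℝ} (ht : t ≤ f 1)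
    (hq : q ∈ Icc (0 : ℝ) 1) : genInv f t ≤ q ↔ t ≤ f q :=
  ⟨fun h => (genInv_mem hf ht).2.trans (hm h), fun h => csInf_le ⟨0, fun _ hr => hr.1.1⟩ ⟨hq, h⟩⟩

/-- The monotone transport map from `α` to `β`. -/
noncomputable def transportMap (α β : Measure ℝ) (u : ℝ) : ℝ :=
  genInv (fun r => β.real (Iic r)) (α.real (Iic u))

lemma real_Iic_le_one {α β : Measure ℝ} [IsFiniteMeasure α] (hβ : β (Ioo 0 1)ᶜ = 0) (hαβ : α univ = β univ) (u : ℝ) :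
    α.real (Iic u) ≤ β.real (Iic 1) := by
  have : β.real (Iic 1) = α.real univ := by
    simp [measureReal_def, real_Iic_eq_univ hβ le_rfl, hαβ]
  rw [this]
  exact measureReal_mono (subset_univ _)

lemma transportMap_mem [NullSingletonClass β] (hβ : β (Ioo 0 1)ᶜ = 0) (hαβ : α univ = β univ) (u : ℝ) :
    transportMap α β u ∈ Icc (0 : ℝ) 1 :=
  (genInv_mem (continuous_real_Iic β) (real_Iic_le_one hβ hαβ u)).1

lemma transportMap_le_iff [NullSingletonClass β] (hβ : β (Ioo 0 1)ᶜ = 0) (hαβ : α univ = β univ) (u : ℝ) {q : ℝ}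
    (hq : q ∈ Icc (0 : ℝ) 1) : transportMap α β u ≤ q ↔ α.real (Iic u) ≤ β.real (Iic q) :=
  genInv_le_iff (continuous_real_Iic β) (mono_real_Iic β) (real_Iic_le_one hβ hαβ u) hq

lemma measurable_transportMap [NullSingletonClass β] (hβ : β (Ioo 0 1)ᶜ = 0) (hαβ : α univ = β univ) :
    Measurable (transportMap α β) := by
  refine Monotone.measurable fun u v h => ?_
  rw [transportMap_le_iff hβ hαβ u (transportMap_mem hβ hαβ v)]
  exact (mono_real_Iic α h).trans
    ((transportMap_le_iff hβ hαβ v (transportMap_mem hβ hαβ v)).1 le_rfl)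

lemma map_transportMap [NullSingletonClass α] [NullSingletonClass β]
    (hα : α (Ioo 0 1)ᶜ = 0) (hβ : β (Ioo 0 1)ᶜ = 0) (hαβ : α univ = β univ) :
    α.map (transportMap α β) = β := by
  refine Measure.ext_of_Iic _ _ fun q => ?_
  rw [Measure.map_apply (measurable_transportMap hβ hαβ) measurableSet_Iic]
  rcases lt_or_ge q 0 with h0 | h0
  · rw [real_Iic_eq_zero hβ h0.le]
    convert measure_empty (μ := α)
    exact eq_empty_of_forall_notMem fun u hu =>
      absurd ((transportMap_mem hβ hαβ u).1.trans hu) (not_le.2 h0)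
  rcases lt_or_ge 1 q with h1 | h1
  · rw [real_Iic_eq_univ hβ h1.le, ← hαβ]
    congr 1
    exact eq_univ_of_forall fun u => (transportMap_mem hβ hαβ u).2.trans h1.le
  have : transportMap α β ⁻¹' Iic q = {u | α.real (Iic u) ≤ β.real (Iic q)} := by
    ext u
    exact transportMap_le_iff hβ hαβ u ⟨h0, h1⟩
  rw [this, measure_setOf_real_Iic_le hα measureReal_nonneg, ofReal_measureReal]
  have : α.real univ = β.real univ := by simp [measureReal_def, hαβ]
  rw [this]
  exact measureReal_mono (subset_univ _)

/-- Write `A` and `B` for the distribution functions of `α` and `β`. If the image of `u` is at most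
a rational `q`, then `A u ≤ B q ≤ A q`, so `u ≤ q` unless `u` lies on a flat stretch of `A` to the
right of `q`, which is `α`-null. A rational strictly between the image and `u` is therefore
excluded. -/
lemma ae_le_transportMap [NullSingletonClass α] [NullSingletonClass β]
    (hα : α (Ioo 0 1)ᶜ = 0) (hβ : β (Ioo 0 1)ᶜ = 0)
    (hαβ : α univ = β univ) (hle : ∀ t ∈ Ioo (0 : ℝ) 1, β (Iic t) ≤ α (Iic t)) :
    ∀ᵐ u ∂α, u ≤ transportMap α β u := by
  have h1 : ∀ q : ℚ, ∀ᵐ u ∂α, (q : ℝ) ∈ Ioo (0 : ℝ) 1 → transportMap α β u ≤ q → u ≤ q := by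
    intro q
    by_cases hq : (q : ℝ) ∈ Ioo (0 : ℝ) 1
    swap
    · exact ae_of_all _ fun u h => absurd h hq
    have hBA : β.real (Iic (q : ℝ)) ≤ α.real (Iic (q : ℝ)) :=
      ENNReal.toReal_mono (measure_ne_top _ _) (hle q hq)
    have hnull : α ({u | α.real (Iic u) ≤ α.real (Iic (q : ℝ))} \ Iic (q : ℝ)) = 0 := by
      have hsub : Iic (q : ℝ) ⊆ {u | α.real (Iic u) ≤ α.real (Iic (q : ℝ))} :=
        fun u hu => mono_real_Iic α hu
      rw [measure_sdiff hsub measurableSet_Iic.nullMeasurableSet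
        (measure_ne_top _ _), measure_setOf_real_Iic_le hα measureReal_nonneg
        (measureReal_mono (subset_univ _)), ofReal_measureReal, tsub_self]
    filter_upwards [measure_eq_zero_iff_ae_notMem.1 hnull] with u hu _ hφ
    by_contra hcon
    exact hu ⟨((transportMap_le_iff hβ hαβ u (Ioo_subset_Icc_self hq)).1 hφ).trans hBA, hcon⟩
  filter_upwards [ae_all_iff.2 h1, measure_eq_zero_iff_ae_notMem.1 hα] with u hu hu01
  rw [notMem_compl_iff] at hu01
  by_contra! hcon
  obtain ⟨q, hq1, hq2⟩ := exists_rat_btwn hcon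
  have := hu q ⟨(transportMap_mem hβ hαβ u).1.trans_lt hq1, hq2.trans hu01.2⟩ hq1.le
  linarith

end QuantileCoupling

/-! ### Coupling two densities inside the fibres of a map. -/

section FibreMatching

/-- The mass that the density `a` puts on the fibre of `s` over `x`. -/
noncomputable def fibreMass (s : ℝ → ℝ) (a : ℝ → ℝ≥0∞) (x : ℝ) : ℝ≥0∞ :=
  ∫⁻ u, (if s u = x then a u else 0) ∂unitLebesgue

/-- The normalisation of the product coupling on a fibre. -/
noncomputable def fibreNorm (s : ℝ → ℝ) (a b : ℝ → ℝ≥0∞) (x : ℝ) : ℝ≥0∞ :=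
  (max (fibreMass s a x) (fibreMass s b x))⁻¹

/-- The part of the densities `a` and `b` that can be coupled inside the fibres of `s`. -/
noncomputable def fibreCoupling (s : ℝ → ℝ) (a b : ℝ → ℝ≥0∞) : Measure (ℝ × ℝ) :=
  (unitLebesgue.prod unitLebesgue).withDensity
    fun z => if s z.1 = s z.2 then fibreNorm s a b (s z.1) * a z.1 * b z.2 else 0

/-- What is left of the density `a` after the coupling inside the fibres of `s`. -/
noncomputable def residual (s : ℝ → ℝ) (a b : ℝ → ℝ≥0∞) (u : ℝ) : ℝ≥0∞ :=
  a u * (1 - fibreNorm s a b (s u) * fibreMass s b (s u))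

lemma fibreNorm_comm (s : ℝ → ℝ) (a b : ℝ → ℝ≥0∞) : fibreNorm s a b = fibreNorm s b a := by
  funext x
  rw [fibreNorm, fibreNorm, max_comm]

variable {s : ℝ → ℝ} (hs : Measurable s) {a b : ℝ → ℝ≥0∞} (ha : Measurable a) (hb : Measurable b)

include hs ha in
@[fun_prop]
lemma measurable_fibreMass : Measurable (fibreMass s a) := by
  have : Measurable fun z : ℝ × ℝ => if s z.2 = z.1 then a z.2 else 0 :=
    Measurable.ite (measurableSet_eq_fun (by fun_prop) (by fun_prop)) (by fun_prop) (by fun_prop)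
  exact this.lintegral_prod_right'

include hs ha hb in
@[fun_prop]
lemma measurable_fibreNorm : Measurable (fibreNorm s a b) :=
  ((measurable_fibreMass hs ha).max (measurable_fibreMass hs hb)).inv

include hs ha hb in
@[fun_prop]
lemma measurable_residual : Measurable (residual s a b) := by
  have h1 := (measurable_fibreNorm hs ha hb).comp hs
  have h2 := (measurable_fibreMass hs hb).comp hs
  exact ha.mul (measurable_const.sub (h1.mul h2))

include hs ha hb in
lemma measurable_fibreCoupling_density :
    Measurable fun z : ℝ × ℝ =>
      if s z.1 = s z.2 then fibreNorm s a b (s z.1) * a z.1 * b z.2 else 0 := by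
  have h1 : Measurable fun z : ℝ × ℝ => fibreNorm s a b (s z.1) :=
    (measurable_fibreNorm hs ha hb).comp (hs.comp measurable_fst)
  exact Measurable.ite (measurableSet_eq_fun (by fun_prop) (by fun_prop))
    ((h1.mul (by fun_prop)).mul (by fun_prop)) (by fun_prop)

lemma fibreMass_ne_top (hfin : ∫⁻ u, a u ∂unitLebesgue ≠ ∞) (x : ℝ) : fibreMass s a x ≠ ∞ := by
  refine ne_top_of_le_ne_top hfin (lintegral_mono fun u => ?_)
  split_ifs <;> simp

/-- Dividing by the larger of the two masses keeps both marginals of the fibre coupling below `a`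
and `b` and exhausts the smaller one. If both masses vanish the product is `∞ * 0 = 0`, so nothing
is coupled there. -/
lemma fibreNorm_mul_le_one (x : ℝ) : fibreNorm s a b x * fibreMass s b x ≤ 1 := by
  rw [fibreNorm, mul_comm, ← div_eq_mul_inv]
  exact ENNReal.div_le_of_le_mul (by rw [one_mul]; exact le_max_right _ _)

lemma residual_add (u : ℝ) :
    residual s a b u + a u * (fibreNorm s a b (s u) * fibreMass s b (s u)) = a u := by
  rw [residual, ← mul_add, tsub_add_cancel_of_le (fibreNorm_mul_le_one _), mul_one]

include hs ha hb in
lemma fibreCoupling_fst : (fibreCoupling s a b).fst = unitLebesgue.withDensity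
    fun u => a u * (fibreNorm s a b (s u) * fibreMass s b (s u)) := by
  have hm := measurable_fibreCoupling_density hs ha hb
  ext B hB
  rw [Measure.fst_apply hB, fibreCoupling, withDensity_apply _ (measurable_fst hB),
    withDensity_apply _ hB, ← lintegral_indicator (measurable_fst hB), ← lintegral_indicator hB,
    lintegral_prod _ (hm.indicator (measurable_fst hB)).aemeasurable]
  refine lintegral_congr fun u => ?_
  by_cases hu : u ∈ B
  · have h1 : ∀ v, (Prod.fst ⁻¹' B).indicator (fun z : ℝ × ℝ => if s z.1 = s z.2 then
        fibreNorm s a b (s z.1) * a z.1 * b z.2 else 0) (u, v)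
        = fibreNorm s a b (s u) * a u * (if s v = s u then b v else 0) := by
      intro v
      rw [indicator_of_mem (show (u, v) ∈ Prod.fst ⁻¹' B from hu)]
      by_cases h : s u = s v
      · simp [h]
      · simp [h, Ne.symm h]
    simp_rw [h1]
    rw [lintegral_const_mul _ (Measurable.ite (measurableSet_eq_fun hs measurable_const) hb
      measurable_const), indicator_of_mem hu, fibreMass]
    ring
  · rw [indicator_of_notMem hu]
    simp [indicator, hu]

include hs ha hb in
lemma fibreCoupling_swap : (fibreCoupling s a b).map Prod.swap = fibreCoupling s b a := by
  have hm := measurable_fibreCoupling_density hs hb ha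
  ext B hB
  rw [Measure.map_apply measurable_swap hB, fibreCoupling, fibreCoupling,
    withDensity_apply _ (measurable_swap hB), withDensity_apply _ hB,
    ← (Measure.measurePreserving_swap (μ := unitLebesgue)
      (ν := unitLebesgue)).setLIntegral_comp_preimage hB hm]
  refine lintegral_congr fun z => ?_
  simp only [Prod.fst_swap, Prod.snd_swap, fibreNorm_comm s b a]
  by_cases h : s z.1 = s z.2
  · simp only [h, if_true]; ring
  · simp [h, Ne.symm h]

include hs ha hb in
lemma residual_add_fst : unitLebesgue.withDensity (residual s a b) + (fibreCoupling s a b).fst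
    = unitLebesgue.withDensity a := by
  rw [fibreCoupling_fst hs ha hb, ← withDensity_add_left (measurable_residual hs ha hb)]
  congr 1
  funext u
  exact residual_add u

include hs ha hb in
lemma residual_add_snd : unitLebesgue.withDensity (residual s b a) + (fibreCoupling s a b).snd
    = unitLebesgue.withDensity b := by
  rw [← Measure.fst_map_swap, fibreCoupling_swap hs ha hb, residual_add_fst hs hb ha]

include hs ha hb in
lemma ae_fibreCoupling :
    ∀ᵐ z ∂fibreCoupling s a b, s z.1 = s z.2 ∧ a z.1 ≠ 0 ∧ b z.2 ≠ 0 := by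
  rw [fibreCoupling, ae_withDensity_iff (measurable_fibreCoupling_density hs ha hb)]
  refine ae_of_all _ fun z hz => ?_
  by_cases h : s z.1 = s z.2
  · rw [if_pos h] at hz
    exact ⟨h, right_ne_zero_of_mul (left_ne_zero_of_mul hz), right_ne_zero_of_mul hz⟩
  · exact absurd (if_neg h) hz

include hs ha hb in
-- Coupled points share a fibre. Hence the coupled part cancels when the two densities are compared
-- on a union of fibres.
lemma fibreCoupling_fst_preimage {C : Set ℝ} (hC : MeasurableSet C) :
    (fibreCoupling s a b).fst (s ⁻¹' C) = (fibreCoupling s a b).snd (s ⁻¹' C) := by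
  rw [Measure.fst_apply (hs hC), Measure.snd_apply (hs hC)]
  refine measure_congr ?_
  filter_upwards [ae_fibreCoupling hs ha hb] with z hz
  refine propext ?_
  change s z.1 ∈ C ↔ s z.2 ∈ C
  rw [hz.1]

include hs ha in
-- Tonelli for `a u` on the pairs `(u, v)` in a common fibre of zero mass. Integrating over `u`
-- first gives the mass of that fibre, which is zero; integrating over `v` first gives `a u` times
-- the length of the fibre of `u`.
lemma ae_fibre_null : ∀ᵐ u ∂unitLebesgue, fibreMass s a (s u) = 0 → a u ≠ 0 →
    unitLebesgue {v | s v = s u} = 0 := by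
  have hP := (measurable_fibreMass hs ha)
  have hset : MeasurableSet {z : ℝ × ℝ | s z.2 = s z.1 ∧ fibreMass s a (s z.1) = 0} :=
    (measurableSet_eq_fun (by fun_prop) (by fun_prop)).inter
      (measurableSet_eq_fun (hP.comp (hs.comp measurable_fst)) measurable_const)
  have hm : Measurable fun z : ℝ × ℝ =>
      if s z.2 = s z.1 ∧ fibreMass s a (s z.1) = 0 then a z.1 else 0 :=
    Measurable.ite hset (by fun_prop) measurable_const
  have h0 : ∫⁻ z, (if s z.2 = s z.1 ∧ fibreMass s a (s z.1) = 0 then a z.1 else 0)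
      ∂(unitLebesgue.prod unitLebesgue) = 0 := by
    rw [lintegral_prod_symm _ hm.aemeasurable]
    refine lintegral_eq_zero_of_ae_eq_zero (ae_of_all _ fun v => ?_)
    by_cases hv : fibreMass s a (s v) = 0
    · refine le_antisymm (le_trans (lintegral_mono fun u => ?_) hv.le) bot_le
      dsimp only
      by_cases h : s v = s u
      · rw [if_pos h.symm]; split_ifs <;> simp
      · simp [h]
    · refine lintegral_eq_zero_of_ae_eq_zero (ae_of_all _ fun u => ?_)
      refine if_neg fun h => hv ?_
      dsimp only at h
      rw [h.1, h.2]
  rw [lintegral_prod _ hm.aemeasurable, lintegral_eq_zero_iff hm.lintegral_prod_right'] at h0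
  filter_upwards [h0] with u hu hPu hau
  simp only [hPu, and_true, Pi.zero_apply] at hu
  have hset' : MeasurableSet {v | s v = s u} := measurableSet_eq_fun hs measurable_const
  have : ∫⁻ v, (if s v = s u then a u else 0) ∂unitLebesgue
      = a u * unitLebesgue {v | s v = s u} := by
    rw [← lintegral_indicator_const hset']
    rfl
  rw [this] at hu
  exact (mul_eq_zero.1 hu).resolve_left hau

include hs in
lemma residual_fibre_eq_zero {x : ℝ}
    (hx : fibreMass s a x ≤ fibreMass s b x) (hfin' : ∫⁻ u, b u ∂unitLebesgue ≠ ∞) :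
    (unitLebesgue.withDensity (residual s a b)) (s ⁻¹' {x}) = 0 := by
  have hI : MeasurableSet (s ⁻¹' {x}) := hs (measurableSet_singleton x)
  rw [withDensity_apply _ hI]
  by_cases h0 : fibreMass s b x = 0
  · have h1 : fibreMass s a x = 0 := le_antisymm (h0 ▸ hx) bot_le
    refine le_antisymm (le_trans ?_ h1.le) bot_le
    rw [← lintegral_indicator hI]
    refine lintegral_mono fun u => ?_
    by_cases hu : s u = x
    · rw [indicator_of_mem (show u ∈ s ⁻¹' {x} from hu), if_pos hu]
      exact (self_le_add_right _ _).trans_eq (residual_add u)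
    · rw [indicator_of_notMem (show u ∉ s ⁻¹' {x} from hu)]; exact bot_le
  · rw [setLIntegral_congr_fun (g := fun _ => 0) hI, lintegral_zero]
    intro u hu
    have hu' : s u = x := hu
    rw [residual, hu', fibreNorm, max_eq_right hx, ENNReal.inv_mul_cancel h0
      (fibreMass_ne_top hfin' x), tsub_self, mul_zero]

include hs ha hb in
-- On unions of fibres the inequality follows by cancelling the coupled part. The set `Iic t` may
-- cut the fibre of `t`, but one of the residuals vanishes on that fibre. If it is that of `a`, the
-- comparison is made with the fibre included; if it is that of `b`, with the fibre excluded.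
lemma residual_Iic_le (hmono : ∀ u ∈ Ioo (0 : ℝ) 1, ∀ v ∈ Ioo (0 : ℝ) 1, u ≤ v → s u ≤ s v)
    (hfin : ∫⁻ u, a u ∂unitLebesgue ≠ ∞) (hfin' : ∫⁻ u, b u ∂unitLebesgue ≠ ∞)
    (hlt : ∀ x, unitLebesgue.withDensity b (s ⁻¹' Iio x)
      ≤ unitLebesgue.withDensity a (s ⁻¹' Iio x))
    (hle : ∀ x, unitLebesgue.withDensity b (s ⁻¹' Iic x)
      ≤ unitLebesgue.withDensity a (s ⁻¹' Iic x))
    {t : ℝ} (ht : t ∈ Ioo (0 : ℝ) 1) :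
    unitLebesgue.withDensity (residual s b a) (Iic t)
      ≤ unitLebesgue.withDensity (residual s a b) (Iic t) := by
  have hRfin : ∀ B, (fibreCoupling s a b).fst B ≠ ∞ := by
    intro B
    have : (unitLebesgue.withDensity a) univ ≠ ∞ := by
      rwa [withDensity_apply _ MeasurableSet.univ, Measure.restrict_univ]
    rw [← residual_add_fst hs ha hb] at this
    exact ne_top_of_le_ne_top this ((measure_mono (subset_univ B)).trans
      (Measure.le_iff'.1 (Measure.le_add_left le_rfl) univ))
  have hC : ∀ C, MeasurableSet C → unitLebesgue.withDensity b (s ⁻¹' C)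
      ≤ unitLebesgue.withDensity a (s ⁻¹' C) →
      unitLebesgue.withDensity (residual s b a) (s ⁻¹' C)
        ≤ unitLebesgue.withDensity (residual s a b) (s ⁻¹' C) := by
    intro C hC h
    rw [← residual_add_fst hs ha hb, ← residual_add_snd hs ha hb, Measure.add_apply,
      Measure.add_apply, ← fibreCoupling_fst_preimage hs ha hb hC] at h
    exact (ENNReal.add_le_add_iff_right (hRfin _)).1 h
  have hac : ∀ f : ℝ → ℝ≥0∞, ∀ᵐ u ∂unitLebesgue.withDensity f, u ∈ Ioo (0 : ℝ) 1 := fun f =>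
    withDensity_absolutelyContinuous _ _ ae_mem_Ioo
  have hmem : ∀ u ∈ Ioo (0 : ℝ) 1, s u < s t → u ≤ t := by
    intro u hu h
    by_contra! hc
    exact absurd (hmono t ht u hu hc.le) (not_le.2 h)
  rcases le_total (fibreMass s a (s t)) (fibreMass s b (s t)) with h | h
  · have hz := residual_fibre_eq_zero hs h hfin'
    calc _ ≤ unitLebesgue.withDensity (residual s b a) (s ⁻¹' Iic (s t)) := by
          refine measure_mono_ae ?_
          filter_upwards [hac (residual s b a)] with u hu hut
          exact hmono u hu t ht hut
      _ ≤ unitLebesgue.withDensity (residual s a b) (s ⁻¹' Iic (s t)) :=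
          hC _ measurableSet_Iic (hle _)
      _ ≤ _ := by
          refine measure_mono_ae ?_
          filter_upwards [hac (residual s a b), measure_eq_zero_iff_ae_notMem.1 hz] with u hu hu' hut
          exact hmem u hu (lt_of_le_of_ne hut hu')
  · have hz := residual_fibre_eq_zero hs h hfin
    calc _ ≤ unitLebesgue.withDensity (residual s b a) (s ⁻¹' Iio (s t)) := by
          refine measure_mono_ae ?_
          filter_upwards [hac (residual s b a), measure_eq_zero_iff_ae_notMem.1 hz] with u hu hu' hut
          exact lt_of_le_of_ne (hmono u hu t ht hut) hu'
      _ ≤ unitLebesgue.withDensity (residual s a b) (s ⁻¹' Iio (s t)) :=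
          hC _ measurableSet_Iio (hlt _)
      _ ≤ _ := by
          refine measure_mono_ae ?_
          filter_upwards [hac (residual s a b)] with u hu hut
          exact hmem u hu hut

include hs ha hb in
lemma ae_residual (hfin' : ∫⁻ u, b u ∂unitLebesgue ≠ ∞) :
    ∀ᵐ u ∂unitLebesgue.withDensity (residual s a b), a u ≠ 0 ∧
      (fibreMass s b (s u) < fibreMass s a (s u) ∨
        fibreMass s a (s u) = fibreMass s b (s u) ∧ unitLebesgue {v | s v = s u} = 0) := by
  rw [ae_withDensity_iff (measurable_residual hs ha hb)]
  filter_upwards [ae_fibre_null hs ha] with u hu hr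
  have hau := left_ne_zero_of_mul hr
  refine ⟨hau, ?_⟩
  by_contra! hcon
  obtain ⟨h1, h2⟩ := hcon
  by_cases h0 : fibreMass s b (s u) = 0
  · have h3 : fibreMass s a (s u) = 0 := le_antisymm (h0 ▸ h1) bot_le
    exact h2 (h3.trans h0.symm) (hu h3 hau)
  · refine hr ?_
    rw [residual, fibreNorm, max_eq_right h1, ENNReal.inv_mul_cancel h0
      (fibreMass_ne_top hfin' _), tsub_self, mul_zero]

include hs ha hb in
-- The first marginal charges only fibres where `b` has mass and, by symmetry, the second only those
-- where `a` has mass.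
lemma fibreCoupling_eq_zero (h : ∀ x, fibreMass s a x = 0 ∨ fibreMass s b x = 0) :
    fibreCoupling s a b = 0 := by
  have key : ∀ {a b : ℝ → ℝ≥0∞}, Measurable a → Measurable b →
      ∀ᵐ z ∂fibreCoupling s a b, fibreMass s b (s z.1) ≠ 0 := by
    intro a b ha hb
    have : ∀ᵐ u ∂(fibreCoupling s a b).fst, fibreMass s b (s u) ≠ 0 := by
      have h2 : Measurable fun u => fibreNorm s a b (s u) :=
        (measurable_fibreNorm hs ha hb).comp hs
      have h3 : Measurable fun u => fibreMass s b (s u) := (measurable_fibreMass hs hb).comp hs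
      rw [fibreCoupling_fst hs ha hb, ae_withDensity_iff (by fun_prop)]
      exact ae_of_all _ fun u hu => right_ne_zero_of_mul (right_ne_zero_of_mul hu)
    exact ae_of_ae_map measurable_fst.aemeasurable this
  have h1 := key ha hb
  have h2 := key hb ha
  rw [← fibreCoupling_swap hs ha hb] at h2
  have h2' := ae_of_ae_map measurable_swap.aemeasurable h2
  rw [← Measure.measure_univ_eq_zero, ← compl_empty]
  have : ∀ᵐ z ∂fibreCoupling s a b, z ∈ (∅ : Set (ℝ × ℝ)) := by
    filter_upwards [h1, h2', ae_fibreCoupling hs ha hb] with z hz1 hz2 hz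
    rcases h (s z.1) with h | h
    · rw [Prod.fst_swap, ← hz.1] at hz2
      exact absurd h hz2
    · exact absurd h hz1
  exact this

end FibreMatching

/-! ### The measures `dΨ₊` and `dΨ₋`, and the jumps of `F_μ`. -/

section Gap

/-- The density of `dΨ₊`; exchanging the two measures gives the density of `dΨ₋`. -/
noncomputable def gap (μ ν : Measure ℝ) (u : ℝ) : ℝ≥0∞ :=
  ENNReal.ofReal (max (quantile μ u - quantile ν u) 0)

lemma dPsiPlus_eq (μ ν : Measure ℝ) : dPsiPlus μ ν = unitLebesgue.withDensity (gap μ ν) := rfl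

lemma dPsiMinus_eq (μ ν : Measure ℝ) : dPsiMinus μ ν = unitLebesgue.withDensity (gap ν μ) := rfl

@[fun_prop]
lemma measurable_gap (μ ν : Measure ℝ) : Measurable (gap μ ν) := by
  unfold gap
  fun_prop

lemma gap_ne_zero_iff {μ ν : Measure ℝ} {u : ℝ} : gap μ ν u ≠ 0 ↔ quantile ν u < quantile μ u := by
  simp [gap]

variable {μ ν : Measure ℝ}

/-- If `F_μ` exceeded `u` at its quantile, the interval in between would lie in the fibre. On null
fibres `u` is thus recovered from `F_μ⁻¹(u)`. -/
lemma cdf_quantile_of_null {u : ℝ} (hu : u ∈ Ioo (0 : ℝ) 1)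
    (h : unitLebesgue {v | quantile μ v = quantile μ u} = 0) : cdf μ (quantile μ u) = u := by
  refine le_antisymm ?_ ((quantile_le_iff μ hu _).1 le_rfl)
  by_contra! hlt
  have hsub : Ioo u (cdf μ (quantile μ u)) ⊆ {v | quantile μ v = quantile μ u} ∩ Ioo 0 1 := by
    intro v hv
    have hv01 : v ∈ Ioo (0 : ℝ) 1 := ⟨hu.1.trans hv.1, hv.2.trans_le (cdf_le_one μ _)⟩
    exact ⟨le_antisymm ((quantile_le_iff μ hv01 _).2 hv.2.le) (quantile_mono μ hu hv01 hv.1.le),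
      hv01⟩
  have hm : MeasurableSet {v | quantile μ v = quantile μ u} :=
    measurableSet_eq_fun (measurable_quantile μ) measurable_const
  rw [unitLebesgue, Measure.restrict_apply hm] at h
  have := measure_mono_null hsub h
  rw [Real.volume_Ioo, ENNReal.ofReal_eq_zero] at this
  linarith

/-- The left end of the jump can belong to the fibre but not to the half-open jump interval, hence
its exclusion. -/
lemma mem_jump_of_quantile_eq {u x : ℝ} (hu : u ∈ Ioo (0 : ℝ) 1) (h : quantile μ u = x)
    (hne : u ≠ Function.leftLim (cdf μ) x) :
    u ∈ Ioc (Function.leftLim (cdf μ) x) (cdf μ x) := by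
  refine ⟨lt_of_le_of_ne ?_ hne.symm, (quantile_le_iff μ hu x).1 h.le⟩
  refine le_of_tendsto ((monotone_cdf μ).tendsto_leftLim x) ?_
  refine eventually_nhdsWithin_of_forall fun y hy => ?_
  by_contra! hc
  exact absurd ((quantile_le_iff μ hu y).2 hc.le) (not_le.2 (h ▸ hy))

lemma fibreMass_eq_zero_of_jump {a : ℝ → ℝ≥0∞} {x : ℝ}
    (h : ∀ u ∈ Ioc (Function.leftLim (cdf μ) x) (cdf μ x), u < 1 → a u = 0) :
    fibreMass (quantile μ) a x = 0 := by
  refine lintegral_eq_zero_of_ae_eq_zero ?_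
  have hne : ∀ᵐ u ∂unitLebesgue, u ≠ Function.leftLim (cdf μ) x :=
    ae_restrict_of_ae (Measure.ae_ne volume _)
  filter_upwards [ae_mem_Ioo, hne] with u hu hne
  by_cases hx : quantile μ u = x
  · rw [if_pos hx, h u (mem_jump_of_quantile_eq hu hx hne) hu.2, Pi.zero_apply]
  · simp [hx]

lemma fibreMass_eq_zero_or (h : SignConstantOnJumps μ ν) (x : ℝ) :
    fibreMass (quantile μ) (gap μ ν) x = 0 ∨ fibreMass (quantile μ) (gap ν μ) x = 0 := by
  rcases h x with h | h
  · exact Or.inr (fibreMass_eq_zero_of_jump fun u hu hu1 => by simp [gap, h u hu hu1])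
  · exact Or.inl (fibreMass_eq_zero_of_jump fun u hu hu1 => by simp [gap, h u hu hu1])

variable [IsProbabilityMeasure μ] [IsProbabilityMeasure ν]

lemma integrable_gap (hμ : FiniteFirstMoment μ) (hν : FiniteFirstMoment ν) :
    Integrable (fun u => max (quantile μ u - quantile ν u) 0) unitLebesgue :=
  ((integrable_quantile μ hμ).sub (integrable_quantile ν hν)).pos_part

lemma lintegral_gap_ne_top (hμ : FiniteFirstMoment μ) (hν : FiniteFirstMoment ν) :
    ∫⁻ u, gap μ ν u ∂unitLebesgue ≠ ∞ :=
  (integrable_gap hμ hν).lintegral_lt_top.ne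

lemma dPsiPlus_apply_eq_ofReal (hμ : FiniteFirstMoment μ) (hν : FiniteFirstMoment ν)
    {A : Set ℝ} (hA : MeasurableSet A) : dPsiPlus μ ν A
      = ENNReal.ofReal (∫ u in A, max (quantile μ u - quantile ν u) 0 ∂unitLebesgue) := by
  rw [dPsiPlus, withDensity_apply _ hA, ofReal_integral_eq_lintegral_ofReal
    (integrable_gap hμ hν).integrableOn (ae_of_all _ fun u => le_max_right _ _)]

lemma setIntegral_gap_sub (hμ : FiniteFirstMoment μ) (hν : FiniteFirstMoment ν) (A : Set ℝ) :
    ∫ u in A, max (quantile μ u - quantile ν u) 0 ∂unitLebesgue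
      - ∫ u in A, max (quantile ν u - quantile μ u) 0 ∂unitLebesgue
      = ∫ u in A, quantile μ u ∂unitLebesgue - ∫ u in A, quantile ν u ∂unitLebesgue := by
  rw [← integral_sub (integrable_gap hμ hν).integrableOn (integrable_gap hν hμ).integrableOn,
    ← integral_sub (integrable_quantile μ hμ).integrableOn (integrable_quantile ν hν).integrableOn]
  refine integral_congr_ae (ae_of_all _ fun u => ?_)
  dsimp only
  rcases le_total (quantile μ u) (quantile ν u) with h | h
  · rw [max_eq_right (by linarith), max_eq_left (by linarith)]; ring
  · rw [max_eq_left (by linarith), max_eq_right (by linarith)]; ring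

/-- The difference of the two masses is the integral of `F_μ⁻¹ - F_ν⁻¹` over a lower set of `(0,1)`,
nonnegative by `setIntegral_quantile_le`. -/
lemma dPsiMinus_le_dPsiPlus (hμ : FiniteFirstMoment μ) (hν : FiniteFirstMoment ν)
    (hcx : ConvexOrder μ ν) {A : Set ℝ} (hA : MeasurableSet A)
    (hlow : ∀ u ∈ Ioo (0 : ℝ) 1, ∀ v ∈ Ioo (0 : ℝ) 1, v ∈ A → u ≤ v → u ∈ A) :
    dPsiMinus μ ν A ≤ dPsiPlus μ ν A := by
  have hIoo : ∀ f, unitLebesgue.withDensity f A = unitLebesgue.withDensity f (A ∩ Ioo 0 1) :=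
    fun f => measure_congr <| by
      have := withDensity_absolutelyContinuous unitLebesgue f ae_mem_Ioo
      filter_upwards [this] with u hu
      exact propext ⟨fun h => ⟨h, hu⟩, fun h => h.1⟩
  have hA' : MeasurableSet (A ∩ Ioo (0 : ℝ) 1) := hA.inter measurableSet_Ioo
  have h := setIntegral_quantile_le hμ hν hcx hA'
    (fun u hu v hv huv => ⟨hlow u hu v hv.2 hv.1 huv, hu⟩)
  have h2 := setIntegral_gap_sub hμ hν (A ∩ Ioo 0 1)
  rw [dPsiMinus_eq, dPsiPlus_eq, hIoo, hIoo (gap μ ν), ← dPsiPlus_eq, ← dPsiPlus_eq,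
    dPsiPlus_apply_eq_ofReal hμ hν hA', dPsiPlus_apply_eq_ofReal hν hμ hA']
  exact ENNReal.ofReal_le_ofReal (by linarith)

lemma dPsiPlus_univ_eq (hμ : FiniteFirstMoment μ) (hν : FiniteFirstMoment ν)
    (hcx : ConvexOrder μ ν) : dPsiPlus μ ν univ = dPsiMinus μ ν univ := by
  have h := integral_quantile_eq hμ hν hcx
  have h2 := setIntegral_gap_sub hμ hν univ
  have h3 : dPsiMinus μ ν univ = dPsiPlus ν μ univ := rfl
  rw [h3, dPsiPlus_apply_eq_ofReal hμ hν .univ, dPsiPlus_apply_eq_ofReal hν hμ .univ]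
  simp only [Measure.restrict_univ] at h2 ⊢
  congr 1
  linarith

lemma psiPlus_eq (μ ν : Measure ℝ) {u : ℝ} (hu : u ∈ Icc (0 : ℝ) 1) :
    psiPlus μ ν u = (dPsiPlus μ ν).real (Iic u) := by
  have hset : (Ioc 0 u : Set ℝ) =ᵐ[volume] (Iic u ∩ Ioo 0 1 : Set ℝ) := by
    have h1 : (Ioc 0 u : Set ℝ) = Iic u ∩ Ioc 0 1 := by
      ext v
      exact ⟨fun h => ⟨h.2, h.1, h.2.trans hu.2⟩, fun h => ⟨h.2.1, h.1⟩⟩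
    rw [h1]
    exact (ae_eq_refl _).inter Ioo_ae_eq_Ioc.symm
  rw [psiPlus, intervalIntegral.integral_of_le hu.1, measureReal_def, dPsiPlus,
    withDensity_apply _ measurableSet_Iic, unitLebesgue,
    Measure.restrict_restrict measurableSet_Iic, Measure.restrict_congr_set hset,
    integral_eq_lintegral_of_nonneg_ae (ae_of_all _ fun v => by exact le_max_right _ _)]
  exact Measurable.aestronglyMeasurable (by fun_prop)

lemma psiMinus_eq (μ ν : Measure ℝ) {u : ℝ} (hu : u ∈ Icc (0 : ℝ) 1) :
    psiMinus μ ν u = (dPsiMinus μ ν).real (Iic u) := psiPlus_eq ν μ hu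

lemma withDensity_compl_Ioo (f : ℝ → ℝ≥0∞) : unitLebesgue.withDensity f (Ioo 0 1)ᶜ = 0 :=
  withDensity_absolutelyContinuous unitLebesgue f ae_mem_Ioo

lemma ofReal_psiPlus_one (hμ : FiniteFirstMoment μ) (hν : FiniteFirstMoment ν) :
    ENNReal.ofReal (psiPlus μ ν 1) = dPsiPlus μ ν univ := by
  have hfin : dPsiPlus μ ν univ ≠ ∞ := by
    rw [dPsiPlus_apply_eq_ofReal hμ hν .univ]; exact ENNReal.ofReal_ne_top
  rw [psiPlus_eq μ ν (by simp), measureReal_def,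
    real_Iic_eq_univ (α := dPsiPlus μ ν) (withDensity_compl_Ioo _) le_rfl]
  exact ENNReal.ofReal_toReal hfin

end Gap

/-! ### Construction of `Q`. -/

section ExistsQ

/-- The part of `dΨ₊` that is left after the coupling inside the jumps of `F_μ`. -/
noncomputable def residualPlus (μ ν : Measure ℝ) : Measure ℝ :=
  unitLebesgue.withDensity (residual (quantile μ) (gap μ ν) (gap ν μ))

/-- The part of `dΨ₋` that is left after the coupling inside the jumps of `F_μ`. -/
noncomputable def residualMinus (μ ν : Measure ℝ) : Measure ℝ :=
  unitLebesgue.withDensity (residual (quantile μ) (gap ν μ) (gap μ ν))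

/-- The coupling of `dΨ₊` and `dΨ₋` that first couples inside the jumps of `F_μ`, and then
monotonically. -/
noncomputable def jumpFirstCoupling (μ ν : Measure ℝ) : Measure (ℝ × ℝ) :=
  fibreCoupling (quantile μ) (gap μ ν) (gap ν μ) +
    (residualPlus μ ν).map fun u => (u, transportMap (residualPlus μ ν) (residualMinus μ ν) u)

/-- The points of `ℝ` on whose fibre under `F_μ⁻¹` the mass of `dΨ₊` dominates. -/
noncomputable def plusSet (μ ν : Measure ℝ) : Set ℝ :=
  {x | fibreMass (quantile μ) (gap ν μ) x < fibreMass (quantile μ) (gap μ ν) x} ∪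
    {x | fibreMass (quantile μ) (gap μ ν) x = fibreMass (quantile μ) (gap ν μ) x ∧
      quantile ν (cdf μ x) < x}

lemma measurableSet_plusSet (μ ν : Measure ℝ) : MeasurableSet (plusSet μ ν) := by
  have hs := measurable_quantile μ
  have h1 := measurable_fibreMass hs (measurable_gap μ ν)
  have h2 := measurable_fibreMass hs (measurable_gap ν μ)
  have h3 := (measurable_quantile ν).comp (monotone_cdf μ).measurable
  exact (measurableSet_lt h2 h1).union
    ((measurableSet_eq_fun h1 h2).inter (measurableSet_lt h3 measurable_id))

variable {μ ν : Measure ℝ} [IsProbabilityMeasure μ] [IsProbabilityMeasure ν]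

instance (f : ℝ → ℝ≥0∞) : NullSingletonClass (unitLebesgue.withDensity f) :=
  ⟨fun x => withDensity_absolutelyContinuous _ _
    (by rw [unitLebesgue]; exact measure_singleton x)⟩

instance : NullSingletonClass (residualPlus μ ν) := by unfold residualPlus; infer_instance

instance : NullSingletonClass (residualMinus μ ν) := by unfold residualMinus; infer_instance

lemma residualPlus_add (μ ν : Measure ℝ) : residualPlus μ ν +
    (fibreCoupling (quantile μ) (gap μ ν) (gap ν μ)).fst = dPsiPlus μ ν :=
  residual_add_fst (measurable_quantile μ) (measurable_gap μ ν) (measurable_gap ν μ)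

lemma residualMinus_add (μ ν : Measure ℝ) : residualMinus μ ν +
    (fibreCoupling (quantile μ) (gap μ ν) (gap ν μ)).snd = dPsiMinus μ ν :=
  residual_add_snd (measurable_quantile μ) (measurable_gap μ ν) (measurable_gap ν μ)

lemma isFiniteMeasure_residual {a b : ℝ → ℝ≥0∞} (h : ∫⁻ u, a u ∂unitLebesgue ≠ ∞) (s : ℝ → ℝ) :
    IsFiniteMeasure (unitLebesgue.withDensity (residual s a b)) :=
  isFiniteMeasure_withDensity (ne_top_of_le_ne_top h (lintegral_mono fun u =>
    (self_le_add_right _ _).trans_eq (residual_add u)))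

variable (hμ : FiniteFirstMoment μ) (hν : FiniteFirstMoment ν) (hcx : ConvexOrder μ ν)

include hμ hν in
lemma isFiniteMeasure_residualPlus : IsFiniteMeasure (residualPlus μ ν) :=
  isFiniteMeasure_residual (lintegral_gap_ne_top hμ hν) _

include hμ hν in
lemma isFiniteMeasure_residualMinus : IsFiniteMeasure (residualMinus μ ν) :=
  isFiniteMeasure_residual (lintegral_gap_ne_top hν hμ) _

include hμ hν hcx in
lemma residual_univ_eq : residualPlus μ ν univ = residualMinus μ ν univ := by
  have h := dPsiPlus_univ_eq hμ hν hcx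
  have hfin : dPsiPlus μ ν univ ≠ ∞ := by
    rw [← ofReal_psiPlus_one hμ hν]; exact ENNReal.ofReal_ne_top
  have hR := fibreCoupling_fst_preimage (measurable_quantile μ) (measurable_gap μ ν)
    (measurable_gap ν μ) MeasurableSet.univ
  rw [preimage_univ] at hR
  rw [← residualPlus_add, Measure.add_apply] at hfin
  rw [← residualPlus_add, ← residualMinus_add, Measure.add_apply, Measure.add_apply, ← hR] at h
  exact (ENNReal.add_left_inj (ENNReal.add_ne_top.1 hfin).2).1 h

include hμ hν hcx in
lemma residual_Iic_le_residual {t : ℝ} (ht : t ∈ Ioo (0 : ℝ) 1) :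
    residualMinus μ ν (Iic t) ≤ residualPlus μ ν (Iic t) := by
  have hs := measurable_quantile μ
  refine residual_Iic_le hs (measurable_gap μ ν) (measurable_gap ν μ)
    (fun u hu v hv h => quantile_mono μ hu hv h) (lintegral_gap_ne_top hμ hν)
    (lintegral_gap_ne_top hν hμ) (fun x => ?_) (fun x => ?_) ht
  · exact dPsiMinus_le_dPsiPlus hμ hν hcx (hs measurableSet_Iio)
      fun u hu v hv hvA huv => (quantile_mono μ hu hv huv).trans_lt hvA
  · exact dPsiMinus_le_dPsiPlus hμ hν hcx (hs measurableSet_Iic)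
      fun u hu v hv hvA huv => (quantile_mono μ hu hv huv).trans hvA

include hμ hν in
-- A residual survives either where its own mass dominates the fibre or on null fibres. On the
-- latter both masses are zero and do not reveal the sign, but `u = F_μ(x)`, so the sign is that of
-- `x - F_ν⁻¹(F_μ(x))`. This is the second piece of `plusSet`.
lemma ae_residualPlus : ∀ᵐ u ∂residualPlus μ ν, u ∈ Ioo (0 : ℝ) 1 ∧
    quantile ν u < quantile μ u ∧ quantile μ u ∈ plusSet μ ν := by
  have h01 : ∀ᵐ u ∂residualPlus μ ν, u ∈ Ioo (0 : ℝ) 1 :=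
    withDensity_absolutelyContinuous _ _ ae_mem_Ioo
  filter_upwards [h01, ae_residual (measurable_quantile μ) (measurable_gap μ ν)
    (measurable_gap ν μ) (lintegral_gap_ne_top hν hμ)] with u hu h
  have hgap := gap_ne_zero_iff.1 h.1
  refine ⟨hu, hgap, ?_⟩
  rcases h.2 with h | h
  · exact Or.inl h
  · exact Or.inr ⟨h.1, by rwa [cdf_quantile_of_null hu h.2]⟩

include hμ hν in
lemma ae_residualMinus : ∀ᵐ u ∂residualMinus μ ν, u ∈ Ioo (0 : ℝ) 1 ∧
    quantile μ u < quantile ν u ∧ quantile μ u ∉ plusSet μ ν := by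
  have h01 : ∀ᵐ u ∂residualMinus μ ν, u ∈ Ioo (0 : ℝ) 1 :=
    withDensity_absolutelyContinuous _ _ ae_mem_Ioo
  filter_upwards [h01, ae_residual (measurable_quantile μ) (measurable_gap ν μ)
    (measurable_gap μ ν) (lintegral_gap_ne_top hμ hν)] with u hu h
  have hgap := gap_ne_zero_iff.1 h.1
  refine ⟨hu, hgap, ?_⟩
  rintro (hx | ⟨hx, hx'⟩)
  · rcases h.2 with h | h
    · exact lt_asymm h hx
    · exact hx.ne h.1
  · rcases h.2 with h | h
    · exact h.ne hx
    · rw [cdf_quantile_of_null hu h.2] at hx'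
      exact lt_asymm hgap hx'

include hμ hν hcx in
lemma measurable_residual_transportMap :
    Measurable (transportMap (residualPlus μ ν) (residualMinus μ ν)) := by
  have := isFiniteMeasure_residualPlus hμ hν
  have := isFiniteMeasure_residualMinus hμ hν
  exact measurable_transportMap (withDensity_compl_Ioo _) (residual_univ_eq hμ hν hcx)

include hμ hν hcx in
lemma map_residual_transportMap :
    (residualPlus μ ν).map (transportMap (residualPlus μ ν) (residualMinus μ ν))
      = residualMinus μ ν := by
  have := isFiniteMeasure_residualPlus hμ hν
  have := isFiniteMeasure_residualMinus hμ hν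
  exact map_transportMap (withDensity_compl_Ioo _) (withDensity_compl_Ioo _)
    (residual_univ_eq hμ hν hcx)

include hμ hν hcx in
lemma ae_residual_transportMap : ∀ᵐ u ∂residualPlus μ ν,
    let v := transportMap (residualPlus μ ν) (residualMinus μ ν) u
    (u ∈ Ioo (0 : ℝ) 1 ∧ v ∈ Ioo (0 : ℝ) 1 ∧ u < v) ∧
      quantile μ u ∈ plusSet μ ν ∧ quantile μ v ∉ plusSet μ ν := by
  have := isFiniteMeasure_residualPlus hμ hν
  have := isFiniteMeasure_residualMinus hμ hν
  have hle := ae_le_transportMap (α := residualPlus μ ν) (β := residualMinus μ ν)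
    (withDensity_compl_Ioo _) (withDensity_compl_Ioo _)
    (residual_univ_eq hμ hν hcx) fun t ht => residual_Iic_le_residual hμ hν hcx ht
  have hv := ae_residualMinus hμ hν
  rw [← map_residual_transportMap hμ hν hcx] at hv
  have hv' := ae_of_ae_map (measurable_residual_transportMap hμ hν hcx).aemeasurable hv
  filter_upwards [ae_residualPlus hμ hν, hv', hle] with u hu hv hle
  -- Equality is impossible: the fibre of `u` is in `plusSet`, that of its image is not.
  refine ⟨⟨hu.1, hv.1, lt_of_le_of_ne hle fun heq => ?_⟩, hu.2.2, hv.2.2⟩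
  rw [← heq] at hv
  exact hv.2.2 hu.2.2

include hμ hν hcx in
lemma ae_jumpFirstCoupling : ∀ᵐ z ∂jumpFirstCoupling μ ν,
    (z.1 ∈ Ioo (0 : ℝ) 1 ∧ z.2 ∈ Ioo (0 : ℝ) 1 ∧ z.1 < z.2) ∧
      (quantile μ z.1 = quantile μ z.2 ∨
        quantile μ z.1 ∈ plusSet μ ν ∧ quantile μ z.2 ∉ plusSet μ ν) := by
  rw [jumpFirstCoupling, ae_add_measure_iff]
  constructor
  · have h01 : ∀ᵐ z ∂fibreCoupling (quantile μ) (gap μ ν) (gap ν μ),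
        z.1 ∈ Ioo (0 : ℝ) 1 ∧ z.2 ∈ Ioo (0 : ℝ) 1 := by
      refine withDensity_absolutelyContinuous _ _ ?_
      have h1 := (Measure.quasiMeasurePreserving_fst (μ := unitLebesgue)
        (ν := unitLebesgue)).ae ae_mem_Ioo
      have h2 := (Measure.quasiMeasurePreserving_snd (μ := unitLebesgue)
        (ν := unitLebesgue)).ae ae_mem_Ioo
      filter_upwards [h1, h2] with z hz1 hz2 using ⟨hz1, hz2⟩
    filter_upwards [h01, ae_fibreCoupling (measurable_quantile μ) (measurable_gap μ ν)
      (measurable_gap ν μ)] with z hz h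
    refine ⟨⟨hz.1, hz.2, ?_⟩, Or.inl h.1⟩
    -- In a common fibre, `v ≤ u` would give `F_ν⁻¹(v) ≤ F_ν⁻¹(u) < F_μ⁻¹(u) = F_μ⁻¹(v) < F_ν⁻¹(v)`.
    by_contra! hle
    have h1 := gap_ne_zero_iff.1 h.2.1
    have h2 := gap_ne_zero_iff.1 h.2.2
    have h3 := quantile_mono ν hz.2 hz.1 hle
    have h4 := h.1
    linarith
  · have hs := measurable_quantile μ
    have hφ := measurable_residual_transportMap hμ hν hcx
    have hm : Measurable fun u => (u, transportMap (residualPlus μ ν) (residualMinus μ ν) u) := by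
      fun_prop
    have hG := measurableSet_plusSet μ ν
    have hset : MeasurableSet {z : ℝ × ℝ |
        (z.1 ∈ Ioo (0 : ℝ) 1 ∧ z.2 ∈ Ioo (0 : ℝ) 1 ∧ z.1 < z.2) ∧
        (quantile μ z.1 = quantile μ z.2 ∨
          quantile μ z.1 ∈ plusSet μ ν ∧ quantile μ z.2 ∉ plusSet μ ν)} := by
      refine MeasurableSet.inter ((measurable_fst measurableSet_Ioo).inter
        ((measurable_snd measurableSet_Ioo).inter
          (measurableSet_lt measurable_fst measurable_snd))) (MeasurableSet.union
          (measurableSet_eq_fun (hs.comp measurable_fst) (hs.comp measurable_snd))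
          (MeasurableSet.inter ((hs.comp measurable_fst) hG)
            ((hs.comp measurable_snd) hG).compl))
    rw [ae_map_iff hm.aemeasurable hset]
    filter_upwards [ae_residual_transportMap hμ hν hcx] with u hu
    exact ⟨hu.1, Or.inr hu.2⟩

include hμ hν hcx in
lemma jumpFirstCoupling_fst : (jumpFirstCoupling μ ν).fst = dPsiPlus μ ν := by
  have hφ := measurable_residual_transportMap hμ hν hcx
  rw [jumpFirstCoupling, Measure.fst_add, Measure.fst_map_prodMk hφ, Measure.map_id', add_comm,
    residualPlus_add]

include hμ hν hcx in
lemma jumpFirstCoupling_snd : (jumpFirstCoupling μ ν).snd = dPsiMinus μ ν := by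
  rw [jumpFirstCoupling, Measure.snd_add, Measure.snd_map_prodMk measurable_id',
    map_residual_transportMap hμ hν hcx, add_comm, residualMinus_add]

include hμ hν hcx in
lemma jumpFirstCoupling_univ :
    jumpFirstCoupling μ ν univ = ENNReal.ofReal (psiPlus μ ν 1) := by
  rw [← Measure.fst_univ, jumpFirstCoupling_fst hμ hν hcx, ofReal_psiPlus_one hμ hν]

include hμ hν hcx in
-- With one sign per jump the fibre coupling vanishes, so the residuals are `dΨ₊` and `dΨ₋`
-- themselves. Their monotone transport agrees almost everywhere with `phi` and takes values in
-- `(0,1)`, so the restriction removes nothing.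
lemma jumpFirstCoupling_eq (h : SignConstantOnJumps μ ν) :
    jumpFirstCoupling μ ν = ((dPsiPlus μ ν).restrict {u | phi μ ν u ∈ Ioo (0 : ℝ) 1}).map
      (fun u => (u, phi μ ν u)) := by
  have hR := fibreCoupling_eq_zero (measurable_quantile μ) (measurable_gap μ ν)
    (measurable_gap ν μ) (fibreMass_eq_zero_or h)
  have hα : residualPlus μ ν = dPsiPlus μ ν := by
    rw [← residualPlus_add, hR, Measure.fst_zero, add_zero]
  have hβ : residualMinus μ ν = dPsiMinus μ ν := by
    rw [← residualMinus_add, hR, Measure.snd_zero, add_zero]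
  have hae : ∀ᵐ u ∂dPsiPlus μ ν, phi μ ν u = transportMap (dPsiPlus μ ν) (dPsiMinus μ ν) u ∧
      phi μ ν u ∈ Ioo (0 : ℝ) 1 := by
    have h1 := ae_residualPlus hμ hν
    have h2 := ae_residual_transportMap hμ hν hcx
    rw [hα] at h1 h2
    rw [hβ] at h2
    filter_upwards [h1, h2] with u hu hu2
    have : phi μ ν u = transportMap (dPsiPlus μ ν) (dPsiMinus μ ν) u := by
      rw [phi, if_pos hu.2.1, transportMap, psiPlus_eq μ ν (Ioo_subset_Icc_self hu.1)]
      exact genInv_congr (fun r hr => psiMinus_eq μ ν hr) _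
    exact ⟨this, this ▸ hu2.1.2.1⟩
  have hrestr : (dPsiPlus μ ν).restrict {u | phi μ ν u ∈ Ioo (0 : ℝ) 1} = dPsiPlus μ ν :=
    Measure.restrict_eq_self_of_ae_mem (hae.mono fun u hu => hu.2)
  rw [hrestr, jumpFirstCoupling, hR, zero_add, hα, hβ]
  refine Measure.map_congr (hae.mono fun u hu => ?_)
  dsimp only
  rw [hu.1]

lemma MQ_congr_of_psiPlus_eq_zero (hμ : FiniteFirstMoment μ) (hν : FiniteFirstMoment ν)
    (hcx : ConvexOrder μ ν) (h0 : psiPlus μ ν 1 = 0) (Q Q' : Measure (ℝ × ℝ)) :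
    MQ μ ν Q = MQ μ ν Q' := by
  have h1 : dPsiPlus μ ν = 0 := by
    rw [← Measure.measure_univ_eq_zero, ← ofReal_psiPlus_one hμ hν, h0, ENNReal.ofReal_zero]
  have h2 : dPsiMinus μ ν = 0 := by
    rw [← Measure.measure_univ_eq_zero, ← dPsiPlus_univ_eq hμ hν hcx, h1]; rfl
  rw [dPsiPlus_eq, withDensity_eq_zero_iff (measurable_gap μ ν).aemeasurable] at h1
  rw [dPsiMinus_eq, withDensity_eq_zero_iff (measurable_gap ν μ).aemeasurable] at h2
  unfold MQ Measure.bind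
  congr 1
  refine Measure.map_congr ?_
  filter_upwards [h1, h2] with u hu1 hu2
  have h3 := not_lt.2 (not_lt.1 (mt gap_ne_zero_iff.2 (not_not.2 hu1)))
  have h4 := not_lt.2 (not_lt.1 (mt gap_ne_zero_iff.2 (not_not.2 hu2)))
  rw [mTilde, mTilde, if_neg h3, if_neg h4, if_neg h3, if_neg h4]

include hμ hν hcx in
lemma exists_mem_QSet : ∃ Q ∈ QSet μ ν,
    (∀ᵐ z ∂(ENNReal.ofReal (psiPlus μ ν 1) • Q), quantile μ z.1 = quantile μ z.2 ∨
      quantile μ z.1 ∈ plusSet μ ν ∧ quantile μ z.2 ∉ plusSet μ ν) ∧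
    (SignConstantOnJumps μ ν → MQ μ ν Q = MIT μ ν) := by
  by_cases h0 : ENNReal.ofReal (psiPlus μ ν 1) = 0
  · have hz : psiPlus μ ν 1 = 0 := by
      refine le_antisymm (ENNReal.ofReal_eq_zero.1 h0) ?_
      rw [psiPlus_eq μ ν (by simp)]
      exact measureReal_nonneg
    have h1 : dPsiPlus μ ν = 0 := by
      rw [← Measure.measure_univ_eq_zero, ← ofReal_psiPlus_one hμ hν, h0]
    have h2 : dPsiMinus μ ν = 0 := by
      rw [← Measure.measure_univ_eq_zero, ← dPsiPlus_univ_eq hμ hν hcx, h1]; rfl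
    -- The marginal conditions read `0 = 0`; any point of `(0,1)²` with `u < v` would do.
    refine ⟨Measure.dirac (1 / 3, 2 / 3), ⟨inferInstance, ?_, ?_, ?_, ?_⟩, ?_, fun _ =>
      MQ_congr_of_psiPlus_eq_zero hμ hν hcx hz _ _⟩
    · rw [ae_dirac_eq]; norm_num
    · rw [h0, h1, zero_smul]
    · rw [h0, h2, zero_smul]
    · rw [ae_dirac_eq]; norm_num
    · rw [h0, zero_smul]; exact ae_zero.symm ▸ eventually_bot
  · have hT : ENNReal.ofReal (psiPlus μ ν 1) ≠ ∞ := ENNReal.ofReal_ne_top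
    have hsmul : ENNReal.ofReal (psiPlus μ ν 1) •
        ((ENNReal.ofReal (psiPlus μ ν 1))⁻¹ • jumpFirstCoupling μ ν) = jumpFirstCoupling μ ν := by
      rw [smul_smul, ENNReal.mul_inv_cancel h0 hT, one_smul]
    have hae := ae_jumpFirstCoupling hμ hν hcx
    refine ⟨(ENNReal.ofReal (psiPlus μ ν 1))⁻¹ • jumpFirstCoupling μ ν, ⟨⟨?_⟩, ?_, ?_, ?_, ?_⟩,
      ?_, fun h => ?_⟩
    · rw [Measure.smul_apply, jumpFirstCoupling_univ hμ hν hcx, smul_eq_mul,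
        ENNReal.inv_mul_cancel h0 hT]
    · exact Measure.ae_smul_measure (hae.mono fun z hz => ⟨hz.1.1, hz.1.2.1⟩) _
    · rw [Measure.fst, ← Measure.map_smul, hsmul, ← Measure.fst, jumpFirstCoupling_fst hμ hν hcx]
    · rw [Measure.snd, ← Measure.map_smul, hsmul, ← Measure.snd, jumpFirstCoupling_snd hμ hν hcx]
    · exact Measure.ae_smul_measure (hae.mono fun z hz => hz.1.2.2) _
    · rw [hsmul]
      exact hae.mono fun z hz => hz.2
    · rw [MIT, QIT, jumpFirstCoupling_eq hμ hν hcx h, one_div, ENNReal.ofReal_inv_of_pos]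
      exact ENNReal.ofReal_pos.1 (pos_iff_ne_zero.2 h0)

end ExistsQ

/-! ### Integration against `M^Q` and `π^HF` in terms of `Q`. -/

section MQFormula

lemma condLaw_eq (ρ : Measure (ℝ × ℝ)) [IsFiniteMeasure ρ] (x : ℝ) :
    condLaw ρ x = ρ.condKernel x := by
  unfold condLaw
  rw [dif_pos]

/-- Where `q` is nonzero, Lebesgue measure is `q⁻¹` times the first marginal of `T • ρ`, and
`condLaw` disintegrates `ρ`. -/
lemma lintegral_condLaw_of_density {ρ : Measure (ℝ × ℝ)} [IsFiniteMeasure ρ] {T : ℝ≥0∞}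
    {q : ℝ → ℝ≥0∞} (hq : Measurable q) (hqt : ∀ u, q u ≠ ∞)
    (h : T • ρ.fst = unitLebesgue.withDensity q) {k : ℝ × ℝ → ℝ≥0∞} (hk : Measurable k) :
    ∫⁻ u, (if q u = 0 then 0 else ∫⁻ v, k (u, v) ∂condLaw ρ u) ∂unitLebesgue
      = ∫⁻ z, (q z.1)⁻¹ * k z ∂(T • ρ) := by
  have hkm : Measurable fun u => ∫⁻ v, k (u, v) ∂ρ.condKernel u :=
    hk.lintegral_kernel_prod_right'
  have hqk : Measurable fun z : ℝ × ℝ => (q z.1)⁻¹ * k z := by fun_prop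
  rw [lintegral_smul_measure, ← Measure.lintegral_condKernel hqk, ← lintegral_smul_measure, h,
    lintegral_withDensity_eq_lintegral_mul _ hq (by exact hqk.lintegral_kernel_prod_right')]
  refine lintegral_congr fun u => ?_
  simp only [Pi.mul_apply]
  rw [lintegral_const_mul _ (by fun_prop), ← mul_assoc]
  by_cases h0 : q u = 0
  · simp [h0]
  · rw [if_neg h0, ENNReal.mul_inv_cancel h0 (hqt u), one_mul]
    simp_rw [condLaw_eq]

variable {μ ν : Measure ℝ}

lemma measurable_twoPoint (u : ℝ) : Measurable (twoPoint μ ν u) := by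
  refine Measure.measurable_of_measurable_coe _ fun B hB => ?_
  have h1 : Measurable fun v => B.indicator (1 : ℝ → ℝ≥0∞) (quantile ν v) :=
    (measurable_one.indicator hB).comp (measurable_quantile ν)
  simp only [twoPoint, Measure.add_apply, Measure.smul_apply, Measure.dirac_apply' _ hB,
    smul_eq_mul]
  fun_prop

/-- The integral of `g` with respect to `twoPoint μ ν u v`. -/
noncomputable def twoPointIntegral (μ ν : Measure ℝ) (g : ℝ × ℝ → ℝ≥0∞) (z : ℝ × ℝ) : ℝ≥0∞ :=
  ENNReal.ofReal ((quantile μ z.1 - quantile ν z.1) / (quantile ν z.2 - quantile ν z.1)) *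
      g (quantile μ z.1, quantile ν z.2) +
    ENNReal.ofReal ((quantile ν z.2 - quantile μ z.1) / (quantile ν z.2 - quantile ν z.1)) *
      g (quantile μ z.1, quantile ν z.1)

lemma measurable_twoPointIntegral {g : ℝ × ℝ → ℝ≥0∞} (hg : Measurable g) :
    Measurable (twoPointIntegral μ ν g) := by
  unfold twoPointIntegral
  fun_prop

lemma lintegral_mTilde (Q : Measure (ℝ × ℝ)) {g : ℝ × ℝ → ℝ≥0∞} (hg : Measurable g) (u : ℝ) :
    ∫⁻ y, g (quantile μ u, y) ∂mTilde μ ν Q u =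
      (if gap μ ν u = 0 then 0 else ∫⁻ v, twoPointIntegral μ ν g (u, v) ∂condLaw Q u) +
      (if gap ν μ u = 0 then 0 else
        ∫⁻ v, twoPointIntegral μ ν g (u, v) ∂condLaw (Q.map Prod.swap) u) +
      {u | quantile μ u = quantile ν u}.indicator
        (fun u => g (quantile μ u, quantile ν u)) u := by
  have hgu : Measurable fun y => g (quantile μ u, y) := by fun_prop
  have hb : ∀ m : Measure ℝ, ∫⁻ y, g (quantile μ u, y) ∂(m.bind (twoPoint μ ν u))
      = ∫⁻ v, twoPointIntegral μ ν g (u, v) ∂m := by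
    intro m
    rw [Measure.lintegral_bind (measurable_twoPoint u).aemeasurable hgu.aemeasurable]
    refine lintegral_congr fun v => ?_
    rw [twoPoint, lintegral_add_measure, lintegral_smul_measure, lintegral_smul_measure,
      lintegral_dirac' _ hgu, lintegral_dirac' _ hgu]
    rfl
  rcases lt_trichotomy (quantile ν u) (quantile μ u) with h | h | h
  · have h1 : gap μ ν u ≠ 0 := gap_ne_zero_iff.2 h
    have h2 : gap ν μ u = 0 := not_not.1 (mt gap_ne_zero_iff.1 h.not_gt)
    rw [mTilde, if_pos h, hb, if_neg h1, if_pos h2,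
      indicator_of_notMem (show u ∉ {u | quantile μ u = quantile ν u} from h.ne'), add_zero,
      add_zero]
  · have h1 : gap μ ν u = 0 := not_not.1 (mt gap_ne_zero_iff.1 h.not_lt)
    have h2 : gap ν μ u = 0 := not_not.1 (mt gap_ne_zero_iff.1 h.not_gt)
    rw [mTilde, if_neg h.not_lt, if_neg h.not_gt, if_pos h1, if_pos h2,
      indicator_of_mem (show u ∈ {u | quantile μ u = quantile ν u} from h.symm),
      lintegral_dirac' _ hgu, add_zero, zero_add]
  · have h1 : gap ν μ u ≠ 0 := gap_ne_zero_iff.2 h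
    have h2 : gap μ ν u = 0 := not_not.1 (mt gap_ne_zero_iff.1 h.not_gt)
    rw [mTilde, if_neg h.not_gt, if_pos h, hb, if_neg h1, if_pos h2,
      indicator_of_notMem (show u ∉ {u | quantile μ u = quantile ν u} from h.ne), add_zero,
      zero_add]

lemma gap_ne_top (u : ℝ) : gap μ ν u ≠ ∞ := ENNReal.ofReal_ne_top

lemma measurableSet_quantile_eq : MeasurableSet {u | quantile μ u = quantile ν u} :=
  measurableSet_eq_fun (measurable_quantile μ) (measurable_quantile ν)

lemma measurable_condLaw_lintegral (ρ : Measure (ℝ × ℝ)) [IsFiniteMeasure ρ] {q : ℝ → ℝ≥0∞}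
    (hq : Measurable q) {k : ℝ × ℝ → ℝ≥0∞} (hk : Measurable k) :
    Measurable fun u => if q u = 0 then 0 else ∫⁻ v, k (u, v) ∂condLaw ρ u := by
  simp_rw [condLaw_eq]
  exact Measurable.ite (measurableSet_eq_fun hq measurable_const) measurable_const
    hk.lintegral_kernel_prod_right'

lemma measurable_lintegral_mTilde (Q : Measure (ℝ × ℝ)) [IsFiniteMeasure Q]
    {g : ℝ × ℝ → ℝ≥0∞} (hg : Measurable g) :
    Measurable fun u => ∫⁻ y, g (quantile μ u, y) ∂mTilde μ ν Q u := by
  simp_rw [lintegral_mTilde Q hg]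
  have hk := measurable_twoPointIntegral (μ := μ) (ν := ν) hg
  refine ((measurable_condLaw_lintegral Q (measurable_gap μ ν) hk).add
    (measurable_condLaw_lintegral (Q.map Prod.swap) (measurable_gap ν μ) hk)).add ?_
  exact Measurable.indicator (by fun_prop) measurableSet_quantile_eq

lemma lintegral_MQ (Q : Measure (ℝ × ℝ)) [IsFiniteMeasure Q] {g : ℝ × ℝ → ℝ≥0∞}
    (hg : Measurable g) : ∫⁻ p, g p ∂MQ μ ν Q
      = ∫⁻ u, ∫⁻ y, g (quantile μ u, y) ∂mTilde μ ν Q u ∂unitLebesgue := by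
  have hmap : ∀ u, Measurable fun y : ℝ => (quantile μ u, y) := fun u => by fun_prop
  have hm : Measurable fun u => (mTilde μ ν Q u).map fun y => (quantile μ u, y) := by
    refine Measure.measurable_of_measurable_coe _ fun B hB => ?_
    have h := measurable_lintegral_mTilde (μ := μ) (ν := ν) Q
      ((measurable_one (α := ℝ≥0∞)).indicator hB)
    convert h using 2 with u
    rw [← lintegral_map (measurable_one.indicator hB) (hmap u), lintegral_indicator_one hB]
  rw [MQ, Measure.lintegral_bind hm.aemeasurable hg.aemeasurable]
  exact lintegral_congr fun u => lintegral_map hg (hmap u)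

lemma lintegral_hoeffdingFrechet {g : ℝ × ℝ → ℝ≥0∞} (hg : Measurable g) :
    ∫⁻ p, g p ∂hoeffdingFrechet μ ν
      = ∫⁻ u, g (quantile μ u, quantile ν u) ∂unitLebesgue := by
  rw [hoeffdingFrechet, lintegral_map hg (by fun_prop)]

/-- The weight of the exchange between the two points of a pair. -/
noncomputable def exchangeWeight (ν : Measure ℝ) (z : ℝ × ℝ) : ℝ≥0∞ :=
  ENNReal.ofReal (1 / (quantile ν z.2 - quantile ν z.1))

/-- The weight that stays at the first point of a pair. -/
noncomputable def stayFst (μ ν : Measure ℝ) (z : ℝ × ℝ) : ℝ≥0∞ :=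
  ENNReal.ofReal
    (1 / (quantile μ z.1 - quantile ν z.1) - 1 / (quantile ν z.2 - quantile ν z.1))

/-- The weight that stays at the second point of a pair. -/
noncomputable def staySnd (μ ν : Measure ℝ) (z : ℝ × ℝ) : ℝ≥0∞ :=
  ENNReal.ofReal
    (1 / (quantile ν z.2 - quantile μ z.2) - 1 / (quantile ν z.2 - quantile ν z.1))

/-- The condition satisfied by almost all pairs under an element of `𝒬`. -/
def GoodPair (μ ν : Measure ℝ) (z : ℝ × ℝ) : Prop :=
  quantile ν z.1 < quantile μ z.1 ∧ quantile μ z.1 ≤ quantile μ z.2 ∧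
    quantile μ z.2 < quantile ν z.2

lemma GoodPair.inv_gap_fst {z : ℝ × ℝ} (hz : GoodPair μ ν z) :
    (gap μ ν z.1)⁻¹ = exchangeWeight ν z + stayFst μ ν z := by
  obtain ⟨h1, h2, h3⟩ := hz
  have h4 : 1 / (quantile ν z.2 - quantile ν z.1) ≤ 1 / (quantile μ z.1 - quantile ν z.1) :=
    one_div_le_one_div_of_le (by linarith) (by linarith)
  have h5 : 0 ≤ 1 / (quantile ν z.2 - quantile ν z.1) := one_div_nonneg.2 (by linarith)
  rw [gap, max_eq_left (by linarith), exchangeWeight, stayFst,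
    ← ENNReal.ofReal_add h5 (by linarith), ← ENNReal.ofReal_inv_of_pos (by linarith)]
  congr 1
  rw [one_div, one_div]; ring

lemma GoodPair.inv_gap_snd {z : ℝ × ℝ} (hz : GoodPair μ ν z) :
    (gap ν μ z.2)⁻¹ = exchangeWeight ν z + staySnd μ ν z := by
  obtain ⟨h1, h2, h3⟩ := hz
  have h4 : 1 / (quantile ν z.2 - quantile ν z.1) ≤ 1 / (quantile ν z.2 - quantile μ z.2) :=
    one_div_le_one_div_of_le (by linarith) (by linarith)
  have h5 : 0 ≤ 1 / (quantile ν z.2 - quantile ν z.1) := one_div_nonneg.2 (by linarith)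
  rw [gap, max_eq_left (by linarith), exchangeWeight, staySnd,
    ← ENNReal.ofReal_add h5 (by linarith), ← ENNReal.ofReal_inv_of_pos (by linarith)]
  congr 1
  rw [one_div, one_div]; ring

/-- Dividing by the gap turns the weight of the far point into `1 / (F_ν⁻¹(v) - F_ν⁻¹(u))`. The
second point of the pair yields the same weight in `GoodPair.twoPoint_snd`, so equal masses are
exchanged. -/
lemma GoodPair.twoPoint_fst {z : ℝ × ℝ} (hz : GoodPair μ ν z) (g : ℝ × ℝ → ℝ≥0∞) :
    (gap μ ν z.1)⁻¹ * twoPointIntegral μ ν g z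
      = exchangeWeight ν z * g (quantile μ z.1, quantile ν z.2)
        + stayFst μ ν z * g (quantile μ z.1, quantile ν z.1) := by
  obtain ⟨h1, h2, h3⟩ := hz
  have e1 : quantile μ z.1 - quantile ν z.1 ≠ 0 := by linarith
  have e2 : quantile ν z.2 - quantile ν z.1 ≠ 0 := by linarith
  rw [gap, max_eq_left (by linarith), exchangeWeight, stayFst, twoPointIntegral, mul_add,
    ← mul_assoc, ← mul_assoc, ← ENNReal.ofReal_inv_of_pos (by linarith),
    ← ENNReal.ofReal_mul (inv_nonneg.2 (by linarith)),
    ← ENNReal.ofReal_mul (inv_nonneg.2 (by linarith))]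
  refine congrArg₂ _ (congrArg (· * _) (congrArg ENNReal.ofReal ?_))
    (congrArg (· * _) (congrArg ENNReal.ofReal ?_))
  · field_simp
  · field_simp; ring

lemma GoodPair.twoPoint_snd {z : ℝ × ℝ} (hz : GoodPair μ ν z) (g : ℝ × ℝ → ℝ≥0∞) :
    (gap ν μ z.2)⁻¹ * twoPointIntegral μ ν g z.swap
      = exchangeWeight ν z * g (quantile μ z.2, quantile ν z.1)
        + staySnd μ ν z * g (quantile μ z.2, quantile ν z.2) := by
  obtain ⟨h1, h2, h3⟩ := hz
  have e1 : quantile ν z.2 - quantile μ z.2 ≠ 0 := by linarith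
  have e2 : quantile ν z.2 - quantile ν z.1 ≠ 0 := by linarith
  have e3 : quantile ν z.1 - quantile ν z.2 ≠ 0 := by linarith
  rw [gap, max_eq_left (by linarith), exchangeWeight, staySnd, twoPointIntegral, mul_add,
    ← mul_assoc, ← mul_assoc, ← ENNReal.ofReal_inv_of_pos (by linarith),
    ← ENNReal.ofReal_mul (inv_nonneg.2 (by linarith)),
    ← ENNReal.ofReal_mul (inv_nonneg.2 (by linarith)), Prod.fst_swap, Prod.snd_swap]
  refine congrArg₂ _ (congrArg (· * _) (congrArg ENNReal.ofReal ?_))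
    (congrArg (· * _) (congrArg ENNReal.ofReal ?_))
  -- With the pair swapped, numerator and denominator are both negative.
  · rw [← neg_sub (quantile ν z.2) (quantile ν z.1), ← neg_sub (quantile ν z.2) (quantile μ z.2),
      neg_div_neg_eq]
    field_simp
  · rw [← neg_sub (quantile ν z.2) (quantile ν z.1), ← neg_sub (quantile μ z.2) (quantile ν z.1),
      neg_div_neg_eq]
    field_simp; ring

variable {Q : Measure (ℝ × ℝ)}

lemma ae_goodPair (hQ : Q ∈ QSet μ ν) :
    ∀ᵐ z ∂(ENNReal.ofReal (psiPlus μ ν 1) • Q), GoodPair μ ν z := by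
  obtain ⟨hp, h01, h1, h2, hlt⟩ := hQ
  have g1 : ∀ᵐ z ∂(ENNReal.ofReal (psiPlus μ ν 1) • Q), quantile ν z.1 < quantile μ z.1 := by
    have : ∀ᵐ u ∂dPsiPlus μ ν, quantile ν u < quantile μ u := by
      rw [dPsiPlus_eq, ae_withDensity_iff (measurable_gap μ ν)]
      exact ae_of_all _ fun u hu => gap_ne_zero_iff.1 hu
    rw [← h1, Measure.fst, ← Measure.map_smul] at this
    exact ae_of_ae_map measurable_fst.aemeasurable this
  have g2 : ∀ᵐ z ∂(ENNReal.ofReal (psiPlus μ ν 1) • Q), quantile μ z.2 < quantile ν z.2 := by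
    have : ∀ᵐ u ∂dPsiMinus μ ν, quantile μ u < quantile ν u := by
      rw [dPsiMinus_eq, ae_withDensity_iff (measurable_gap ν μ)]
      exact ae_of_all _ fun u hu => gap_ne_zero_iff.1 hu
    rw [← h2, Measure.snd, ← Measure.map_smul] at this
    exact ae_of_ae_map measurable_snd.aemeasurable this
  filter_upwards [g1, g2, Measure.ae_smul_measure h01 _, Measure.ae_smul_measure hlt _]
    with z hz1 hz2 hz3 hz4
  exact ⟨hz1, quantile_mono μ hz3.1 hz3.2 hz4.le, hz2⟩

/-- Lebesgue measure is split by the sign of `F_μ⁻¹ - F_ν⁻¹`, and both nonzero parts are rewritten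
over the same pairs. Applied to `M^Q` and to `π^HF`, this makes them comparable pair by pair. -/
lemma lintegral_split (hQ : Q ∈ QSet μ ν) {k : ℝ × ℝ → ℝ≥0∞} (hk : Measurable k)
    (g : ℝ → ℝ≥0∞) :
    ∫⁻ u, ((if gap μ ν u = 0 then 0 else ∫⁻ v, k (u, v) ∂condLaw Q u) +
      (if gap ν μ u = 0 then 0 else ∫⁻ v, k (u, v) ∂condLaw (Q.map Prod.swap) u) +
      {u | quantile μ u = quantile ν u}.indicator g u) ∂unitLebesgue
    = ∫⁻ z, ((gap μ ν z.1)⁻¹ * k z + (gap ν μ z.2)⁻¹ * k z.swap)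
        ∂(ENNReal.ofReal (psiPlus μ ν 1) • Q)
      + ∫⁻ u in {u | quantile μ u = quantile ν u}, g u ∂unitLebesgue := by
  obtain ⟨hp, h01, h1, h2, hlt⟩ := hQ
  have hswap : ENNReal.ofReal (psiPlus μ ν 1) • (Q.map Prod.swap).fst
      = unitLebesgue.withDensity (gap ν μ) := by
    rw [Measure.fst_map_swap, h2, dPsiMinus_eq]
  have m1 := measurable_condLaw_lintegral Q (measurable_gap μ ν) hk
  have m2 := measurable_condLaw_lintegral (Q.map Prod.swap) (measurable_gap ν μ) hk
  have m3 : Measurable fun z : ℝ × ℝ => (gap μ ν z.1)⁻¹ * k z := by fun_prop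
  have m4 : Measurable fun z : ℝ × ℝ => (gap ν μ z.1)⁻¹ * k z := by fun_prop
  have m12 : Measurable fun u => (if gap μ ν u = 0 then 0 else ∫⁻ v, k (u, v) ∂condLaw Q u) +
      (if gap ν μ u = 0 then 0 else ∫⁻ v, k (u, v) ∂condLaw (Q.map Prod.swap) u) := m1.add m2
  rw [lintegral_add_left m12, lintegral_add_left m1, lintegral_add_left m3,
    lintegral_indicator measurableSet_quantile_eq,
    lintegral_condLaw_of_density (measurable_gap μ ν) gap_ne_top h1 hk,
    lintegral_condLaw_of_density (measurable_gap ν μ) gap_ne_top hswap hk,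
    ← Measure.map_smul, lintegral_map m4 measurable_swap]
  rfl

lemma lintegral_MQ_eq (hQ : Q ∈ QSet μ ν) {g : ℝ × ℝ → ℝ≥0∞} (hg : Measurable g) :
    ∫⁻ p, g p ∂MQ μ ν Q = ∫⁻ z, ((exchangeWeight ν z * g (quantile μ z.1, quantile ν z.2)
        + stayFst μ ν z * g (quantile μ z.1, quantile ν z.1)) +
        (exchangeWeight ν z * g (quantile μ z.2, quantile ν z.1)
        + staySnd μ ν z * g (quantile μ z.2, quantile ν z.2)))
          ∂(ENNReal.ofReal (psiPlus μ ν 1) • Q)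
      + ∫⁻ u in {u | quantile μ u = quantile ν u}, g (quantile μ u, quantile ν u)
          ∂unitLebesgue := by
  have hp : IsProbabilityMeasure Q := hQ.1
  rw [lintegral_MQ Q hg]
  simp_rw [lintegral_mTilde Q hg]
  rw [lintegral_split hQ (measurable_twoPointIntegral hg)]
  congr 1
  refine lintegral_congr_ae ?_
  filter_upwards [ae_goodPair hQ] with z hz
  rw [hz.twoPoint_fst, hz.twoPoint_snd]

lemma lintegral_hoeffdingFrechet_eq (hQ : Q ∈ QSet μ ν) {g : ℝ × ℝ → ℝ≥0∞}
    (hg : Measurable g) :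
    ∫⁻ p, g p ∂hoeffdingFrechet μ ν =
      ∫⁻ z, ((exchangeWeight ν z + stayFst μ ν z) * g (quantile μ z.1, quantile ν z.1) +
        (exchangeWeight ν z + staySnd μ ν z) * g (quantile μ z.2, quantile ν z.2))
          ∂(ENNReal.ofReal (psiPlus μ ν 1) • Q)
      + ∫⁻ u in {u | quantile μ u = quantile ν u}, g (quantile μ u, quantile ν u)
          ∂unitLebesgue := by
  have hp : IsProbabilityMeasure Q := hQ.1
  have hp' : IsProbabilityMeasure (Q.map Prod.swap) :=
    Measure.isProbabilityMeasure_map measurable_swap.aemeasurable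
  have hsplit := lintegral_split hQ (k := fun z => g (quantile μ z.1, quantile ν z.1))
    (by fun_prop) fun u => g (quantile μ u, quantile ν u)
  rw [lintegral_hoeffdingFrechet hg]
  refine (lintegral_congr fun u => ?_).trans (hsplit.trans ?_)
  · simp only [condLaw_eq, lintegral_const, measure_univ, mul_one]
    rcases lt_trichotomy (quantile ν u) (quantile μ u) with h | h | h
    · have h1 : gap μ ν u ≠ 0 := gap_ne_zero_iff.2 h
      have h2 : gap ν μ u = 0 := not_not.1 (mt gap_ne_zero_iff.1 h.not_gt)
      rw [if_neg h1, if_pos h2,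
        indicator_of_notMem (show u ∉ {u | quantile μ u = quantile ν u} from h.ne'), add_zero,
        add_zero]
    · have h1 : gap μ ν u = 0 := not_not.1 (mt gap_ne_zero_iff.1 h.not_lt)
      have h2 : gap ν μ u = 0 := not_not.1 (mt gap_ne_zero_iff.1 h.not_gt)
      rw [if_pos h1, if_pos h2,
        indicator_of_mem (show u ∈ {u | quantile μ u = quantile ν u} from h.symm), add_zero,
        zero_add]
    · have h1 : gap ν μ u ≠ 0 := gap_ne_zero_iff.2 h
      have h2 : gap μ ν u = 0 := not_not.1 (mt gap_ne_zero_iff.1 h.not_gt)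
      rw [if_neg h1, if_pos h2,
        indicator_of_notMem (show u ∉ {u | quantile μ u = quantile ν u} from h.ne), add_zero,
        zero_add]
  · congr 1
    refine lintegral_congr_ae ?_
    filter_upwards [ae_goodPair hQ] with z hz
    rw [hz.inv_gap_fst, hz.inv_gap_snd, Prod.fst_swap]

end MQFormula

/-! ### Marginals, martingale property and stochastic order of `M^Q`. -/

section MQProperties

variable {μ ν : Measure ℝ} {Q : Measure (ℝ × ℝ)}

lemma hoeffdingFrechet_fst [IsProbabilityMeasure μ] : (hoeffdingFrechet μ ν).fst = μ := by
  rw [hoeffdingFrechet, Measure.fst_map_prodMk (measurable_quantile ν), map_quantile]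

lemma hoeffdingFrechet_snd [IsProbabilityMeasure ν] : (hoeffdingFrechet μ ν).snd = ν := by
  rw [hoeffdingFrechet, Measure.snd_map_prodMk (measurable_quantile μ), map_quantile]

instance : IsProbabilityMeasure (hoeffdingFrechet μ ν) :=
  Measure.isProbabilityMeasure_map (by fun_prop)

lemma MQ_fst_eq (hQ : Q ∈ QSet μ ν) : (MQ μ ν Q).fst = (hoeffdingFrechet μ ν).fst := by
  refine Measure.ext_of_lintegral _ fun g hg => ?_
  rw [Measure.fst, Measure.fst, lintegral_map hg measurable_fst, lintegral_map hg measurable_fst,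
    lintegral_MQ_eq hQ (by fun_prop), lintegral_hoeffdingFrechet_eq hQ (by fun_prop)]
  simp only [add_mul]

/-- The exchange within a pair only permutes equal masses at the two `ν`-quantiles. -/
lemma MQ_snd_eq (hQ : Q ∈ QSet μ ν) : (MQ μ ν Q).snd = (hoeffdingFrechet μ ν).snd := by
  refine Measure.ext_of_lintegral _ fun g hg => ?_
  rw [Measure.snd, Measure.snd, lintegral_map hg measurable_snd, lintegral_map hg measurable_snd,
    lintegral_MQ_eq hQ (by fun_prop), lintegral_hoeffdingFrechet_eq hQ (by fun_prop)]
  congr 1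
  refine lintegral_congr fun z => ?_
  ring

lemma MQ_isCoupling [IsProbabilityMeasure μ] [IsProbabilityMeasure ν] (hQ : Q ∈ QSet μ ν) :
    IsCoupling μ ν (MQ μ ν Q) :=
  ⟨by rw [MQ_fst_eq hQ, hoeffdingFrechet_fst], by rw [MQ_snd_eq hQ, hoeffdingFrechet_snd]⟩

lemma IsCoupling.isProbabilityMeasure {p q : Measure ℝ} [IsProbabilityMeasure p]
    {π : Measure (ℝ × ℝ)} (h : IsCoupling p q π) : IsProbabilityMeasure π :=
  ⟨by rw [← Measure.fst_univ, h.1, measure_univ]⟩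

/-- A barycentre identity with negative parts carried across, so that it can be integrated in `ℝ≥0∞`
without subtraction. -/
lemma ofReal_combination {w w' a c x : ℝ} (hw : 0 ≤ w) (hw' : 0 ≤ w')
    (h : w * c + w' * a = (w + w') * x) :
    ENNReal.ofReal w * ENNReal.ofReal c + ENNReal.ofReal w' * ENNReal.ofReal a
        + (ENNReal.ofReal w + ENNReal.ofReal w') * ENNReal.ofReal (-x)
      = ENNReal.ofReal w * ENNReal.ofReal (-c) + ENNReal.ofReal w' * ENNReal.ofReal (-a)
        + (ENNReal.ofReal w + ENNReal.ofReal w') * ENNReal.ofReal x := by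
  have key : ∀ y : ℝ, ENNReal.ofReal y = ENNReal.ofReal (max y 0) := fun y => by
    rcases le_total y 0 with h | h
    · rw [max_eq_right h, ENNReal.ofReal_of_nonpos h, ENNReal.ofReal_zero]
    · rw [max_eq_left h]
  have hmax : ∀ y : ℝ, max y 0 = y + max (-y) 0 := fun y => by
    rcases le_total y 0 with h | h
    · rw [max_eq_right h, max_eq_left (by linarith)]; ring
    · rw [max_eq_left h, max_eq_right (by linarith)]; ring
  rw [key c, key a, key x, key (-c), key (-a), key (-x), ← ENNReal.ofReal_add hw hw',
    ← ENNReal.ofReal_mul hw, ← ENNReal.ofReal_mul hw, ← ENNReal.ofReal_mul hw',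
    ← ENNReal.ofReal_mul hw', ← ENNReal.ofReal_mul (add_nonneg hw hw'),
    ← ENNReal.ofReal_mul (add_nonneg hw hw'), ← ENNReal.ofReal_add (by positivity) (by positivity),
    ← ENNReal.ofReal_add (by positivity) (by positivity),
    ← ENNReal.ofReal_add (by positivity) (by positivity),
    ← ENNReal.ofReal_add (by positivity) (by positivity), hmax c, hmax a, hmax x]
  congr 1
  linear_combination h

lemma GoodPair.fst_combination {z : ℝ × ℝ} (hz : GoodPair μ ν z) :
    exchangeWeight ν z * ENNReal.ofReal (quantile ν z.2)
        + stayFst μ ν z * ENNReal.ofReal (quantile ν z.1)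
        + (exchangeWeight ν z + stayFst μ ν z) * ENNReal.ofReal (-quantile μ z.1)
      = exchangeWeight ν z * ENNReal.ofReal (-quantile ν z.2)
        + stayFst μ ν z * ENNReal.ofReal (-quantile ν z.1)
        + (exchangeWeight ν z + stayFst μ ν z) * ENNReal.ofReal (quantile μ z.1) := by
  obtain ⟨h1, h2, h3⟩ := hz
  have h4 : 1 / (quantile ν z.2 - quantile ν z.1) ≤ 1 / (quantile μ z.1 - quantile ν z.1) :=
    one_div_le_one_div_of_le (by linarith) (by linarith)
  have e1 : quantile μ z.1 - quantile ν z.1 ≠ 0 := by linarith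
  have e2 : quantile ν z.2 - quantile ν z.1 ≠ 0 := by linarith
  refine ofReal_combination (one_div_nonneg.2 (by linarith)) (by linarith) ?_
  field_simp
  ring

lemma GoodPair.snd_combination {z : ℝ × ℝ} (hz : GoodPair μ ν z) :
    exchangeWeight ν z * ENNReal.ofReal (quantile ν z.1)
        + staySnd μ ν z * ENNReal.ofReal (quantile ν z.2)
        + (exchangeWeight ν z + staySnd μ ν z) * ENNReal.ofReal (-quantile μ z.2)
      = exchangeWeight ν z * ENNReal.ofReal (-quantile ν z.1)
        + staySnd μ ν z * ENNReal.ofReal (-quantile ν z.2)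
        + (exchangeWeight ν z + staySnd μ ν z) * ENNReal.ofReal (quantile μ z.2) := by
  obtain ⟨h1, h2, h3⟩ := hz
  have h4 : 1 / (quantile ν z.2 - quantile ν z.1) ≤ 1 / (quantile ν z.2 - quantile μ z.2) :=
    one_div_le_one_div_of_le (by linarith) (by linarith)
  have e1 : quantile ν z.2 - quantile μ z.2 ≠ 0 := by linarith
  have e2 : quantile ν z.2 - quantile ν z.1 ≠ 0 := by linarith
  refine ofReal_combination (one_div_nonneg.2 (by linarith)) (by linarith) ?_
  field_simp
  ring

@[fun_prop]
lemma measurable_exchangeWeight : Measurable (exchangeWeight ν) := by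
  unfold exchangeWeight; fun_prop

@[fun_prop]
lemma measurable_stayFst : Measurable (stayFst μ ν) := by
  unfold stayFst; fun_prop

@[fun_prop]
lemma measurable_staySnd : Measurable (staySnd μ ν) := by
  unfold staySnd; fun_prop

/-- The martingale property tested against `f`, in subtraction-free form. It holds pair by pair,
since the weights at each point of a pair have barycentre `F_μ⁻¹` there. -/
lemma MQ_balance (hQ : Q ∈ QSet μ ν) {f : ℝ → ℝ≥0∞} (hf : Measurable f) :
    ∫⁻ p, f p.1 * ENNReal.ofReal p.2 ∂MQ μ ν Q
        + ∫⁻ p, f p.1 * ENNReal.ofReal (-p.1) ∂hoeffdingFrechet μ ν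
      = ∫⁻ p, f p.1 * ENNReal.ofReal (-p.2) ∂MQ μ ν Q
        + ∫⁻ p, f p.1 * ENNReal.ofReal p.1 ∂hoeffdingFrechet μ ν := by
  rw [lintegral_MQ_eq hQ (by fun_prop), lintegral_MQ_eq hQ (by fun_prop),
    lintegral_hoeffdingFrechet_eq hQ (by fun_prop), lintegral_hoeffdingFrechet_eq hQ (by fun_prop)]
  refine (add_add_add_comm _ _ _ _).trans (Eq.trans ?_ (add_add_add_comm _ _ _ _))
  congr 1
  · rw [← lintegral_add_right _ (by fun_prop), ← lintegral_add_right _ (by fun_prop)]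
    refine lintegral_congr_ae ?_
    filter_upwards [ae_goodPair hQ] with z hz
    have key := congrArg₂ (· + ·) (congrArg (f (quantile μ z.1) * ·) hz.fst_combination)
      (congrArg (f (quantile μ z.2) * ·) hz.snd_combination)
    refine Eq.trans ?_ (key.trans ?_) <;> ring
  · rw [← lintegral_add_right _ (by fun_prop), ← lintegral_add_right _ (by fun_prop)]
    refine setLIntegral_congr_fun measurableSet_quantile_eq fun u hu => ?_
    have hu' : quantile μ u = quantile ν u := hu
    dsimp only
    rw [hu', add_comm]

/-- A pair inside one fibre contributes equally to both sides. For any other pair only the first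
point can lie over `S`, and there the exchange moves mass upwards. -/
lemma MQ_prod_Iic_le (hQ : Q ∈ QSet μ ν) {G : Set ℝ}
    (hG : ∀ᵐ z ∂(ENNReal.ofReal (psiPlus μ ν 1) • Q), quantile μ z.1 = quantile μ z.2 ∨
      quantile μ z.1 ∈ G ∧ quantile μ z.2 ∉ G) {S : Set ℝ} (hS : MeasurableSet S) (hSG : S ⊆ G)
    (t : ℝ) : MQ μ ν Q (S ×ˢ Iic t) ≤ hoeffdingFrechet μ ν (S ×ˢ Iic t) := by
  have hB : MeasurableSet (S ×ˢ Iic t) := hS.prod measurableSet_Iic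
  have hm : Measurable ((S ×ˢ Iic t).indicator (1 : ℝ × ℝ → ℝ≥0∞)) := measurable_one.indicator hB
  rw [← lintegral_indicator_one hB, ← lintegral_indicator_one hB, lintegral_MQ_eq hQ hm,
    lintegral_hoeffdingFrechet_eq hQ hm]
  refine add_le_add_left (lintegral_mono_ae ?_) _
  filter_upwards [hG, ae_goodPair hQ] with z hz hg
  have hac : quantile ν z.1 ≤ quantile ν z.2 := hg.1.le.trans (hg.2.1.trans hg.2.2.le)
  rcases hz with hz | hz
  · rw [hz]
    exact le_of_eq (by ring)
  · have h1 : ∀ y, (quantile μ z.2, y) ∉ S ×ˢ Iic t := fun y h => hz.2 (hSG h.1)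
    rw [indicator_of_notMem (h1 _), indicator_of_notMem (h1 _)]
    simp only [mul_zero, add_zero, add_mul]
    gcongr
    by_cases hc : (quantile μ z.1, quantile ν z.2) ∈ S ×ˢ Iic t
    · rw [indicator_of_mem hc, indicator_of_mem (show (quantile μ z.1, quantile ν z.1) ∈ S ×ˢ Iic t from ⟨hc.1, mem_Iic.2 (hac.trans hc.2)⟩)]
      rfl
    · rw [indicator_of_notMem hc]; exact bot_le

lemma prod_Iic_le_MQ (hQ : Q ∈ QSet μ ν) {G : Set ℝ}
    (hG : ∀ᵐ z ∂(ENNReal.ofReal (psiPlus μ ν 1) • Q), quantile μ z.1 = quantile μ z.2 ∨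
      quantile μ z.1 ∈ G ∧ quantile μ z.2 ∉ G) {S : Set ℝ} (hS : MeasurableSet S) (hSG : S ⊆ Gᶜ)
    (t : ℝ) : hoeffdingFrechet μ ν (S ×ˢ Iic t) ≤ MQ μ ν Q (S ×ˢ Iic t) := by
  have hB : MeasurableSet (S ×ˢ Iic t) := hS.prod measurableSet_Iic
  have hm : Measurable ((S ×ˢ Iic t).indicator (1 : ℝ × ℝ → ℝ≥0∞)) := measurable_one.indicator hB
  rw [← lintegral_indicator_one hB, ← lintegral_indicator_one hB, lintegral_MQ_eq hQ hm,
    lintegral_hoeffdingFrechet_eq hQ hm]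
  refine add_le_add_left (lintegral_mono_ae ?_) _
  filter_upwards [hG, ae_goodPair hQ] with z hz hg
  have hac : quantile ν z.1 ≤ quantile ν z.2 := hg.1.le.trans (hg.2.1.trans hg.2.2.le)
  rcases hz with hz | hz
  · rw [hz]
    exact le_of_eq (by ring)
  · have h1 : ∀ y, (quantile μ z.1, y) ∉ S ×ˢ Iic t := fun y h => hSG h.1 hz.1
    rw [indicator_of_notMem (h1 _), indicator_of_notMem (h1 _)]
    simp only [mul_zero, zero_add, add_mul]
    gcongr
    by_cases hc : (quantile μ z.2, quantile ν z.2) ∈ S ×ˢ Iic t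
    · rw [indicator_of_mem hc, indicator_of_mem (show (quantile μ z.2, quantile ν z.1) ∈ S ×ˢ Iic t from ⟨hc.1, mem_Iic.2 (hac.trans hc.2)⟩)]
      rfl
    · rw [indicator_of_notMem hc]; exact bot_le

lemma IsCoupling.integrable_snd {M : Measure (ℝ × ℝ)} (hM : IsCoupling μ ν M)
    (hν : FiniteFirstMoment ν) : Integrable (fun p : ℝ × ℝ => p.2) M := by
  have h : Integrable (fun x : ℝ => x) M.snd := by rw [hM.2]; exact hν
  exact (integrable_map_measure measurable_id.aestronglyMeasurable
    measurable_snd.aemeasurable).1 h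

lemma IsCoupling.integrable_fst {M : Measure (ℝ × ℝ)} (hM : IsCoupling μ ν M)
    (hμ : FiniteFirstMoment μ) : Integrable (fun p : ℝ × ℝ => p.1) M := by
  have h : Integrable (fun x : ℝ => x) M.fst := by rw [hM.1]; exact hμ
  exact (integrable_map_measure measurable_id.aestronglyMeasurable
    measurable_fst.aemeasurable).1 h

variable [IsProbabilityMeasure μ] [IsProbabilityMeasure ν]

lemma setIntegral_MQ (hμ : FiniteFirstMoment μ) (hν : FiniteFirstMoment ν) (hQ : Q ∈ QSet μ ν)
    {S : Set ℝ} (hS : MeasurableSet S) :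
    ∫ p in S ×ˢ univ, p.2 ∂MQ μ ν Q = ∫ x in S, x ∂μ := by
  have hM := MQ_isCoupling hQ
  have hHF : IsCoupling μ ν (hoeffdingFrechet μ ν) := ⟨hoeffdingFrechet_fst, hoeffdingFrechet_snd⟩
  have hSu : MeasurableSet (S ×ˢ (univ : Set ℝ)) := hS.prod MeasurableSet.univ
  have i1 := (hM.integrable_snd hν).restrict (s := S ×ˢ univ)
  have i2 := (hHF.integrable_fst hμ).restrict (s := S ×ˢ univ)
  have e : ∫ x in S, x ∂μ = ∫ p in S ×ˢ univ, p.1 ∂hoeffdingFrechet μ ν := by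
    conv_lhs => rw [← hHF.1]
    rw [Measure.fst, setIntegral_map hS (by fun_prop) measurable_fst.aemeasurable, prod_univ]
  have hind : ∀ (N : Measure (ℝ × ℝ)) {g : ℝ × ℝ → ℝ≥0∞},
      ∫⁻ p in S ×ˢ univ, g p ∂N = ∫⁻ p, S.indicator 1 p.1 * g p ∂N := by
    intro N g
    rw [← lintegral_indicator hSu]
    refine lintegral_congr fun p => ?_
    by_cases hp : p.1 ∈ S
    · rw [indicator_of_mem (show p ∈ S ×ˢ univ from ⟨hp, trivial⟩), indicator_of_mem hp,
        Pi.one_apply, one_mul]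
    · rw [indicator_of_notMem (fun h : p ∈ S ×ˢ univ => hp h.1), indicator_of_notMem hp, zero_mul]
  have hb := MQ_balance hQ (f := S.indicator 1) (measurable_one.indicator hS)
  rw [← hind, ← hind, ← hind, ← hind] at hb
  have t1 := i1.lintegral_lt_top.ne
  have t2 := i2.lintegral_lt_top.ne
  have t3 : ∫⁻ p in S ×ˢ univ, ENNReal.ofReal (-p.2) ∂MQ μ ν Q ≠ ∞ :=
    i1.neg.lintegral_lt_top.ne
  have t4 : ∫⁻ p in S ×ˢ univ, ENNReal.ofReal (-p.1) ∂hoeffdingFrechet μ ν ≠ ∞ :=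
    i2.neg.lintegral_lt_top.ne
  rw [e, integral_eq_lintegral_pos_part_sub_lintegral_neg_part i1,
    integral_eq_lintegral_pos_part_sub_lintegral_neg_part i2]
  have hb' := congrArg ENNReal.toReal hb
  rw [ENNReal.toReal_add t1 t4, ENNReal.toReal_add t3 t2] at hb'
  linarith

lemma MQ_isMartingaleCoupling (hμ : FiniteFirstMoment μ) (hν : FiniteFirstMoment ν)
    (hQ : Q ∈ QSet μ ν) : IsMartingaleCoupling μ ν (MQ μ ν Q) := by
  have hM := MQ_isCoupling hQ
  have hp : IsProbabilityMeasure (MQ μ ν Q) := hM.isProbabilityMeasure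
  have hi := hM.integrable_snd hν
  refine ⟨hM, ?_⟩
  simp_rw [condLaw_eq]
  have hci : Integrable (fun x => ∫ y, y ∂(MQ μ ν Q).condKernel x) μ := by
    have := hi.integral_condKernel
    rwa [hM.1] at this
  refine hci.ae_eq_of_forall_setIntegral_eq _ _ hμ fun S hS _ => ?_
  rw [← setIntegral_MQ hμ hν hQ hS, ← Measure.setIntegral_condKernel_univ_right hS
    hi.integrableOn, hM.1]

lemma ae_condLaw_Iic_le (hQ : Q ∈ QSet μ ν) {G : Set ℝ} (hGm : MeasurableSet G)
    (hG : ∀ᵐ z ∂(ENNReal.ofReal (psiPlus μ ν 1) • Q), quantile μ z.1 = quantile μ z.2 ∨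
      quantile μ z.1 ∈ G ∧ quantile μ z.2 ∉ G) :
    ∀ᵐ x ∂μ, (∀ q : ℚ, condLaw (MQ μ ν Q) x (Iic q) ≤ condLaw (hoeffdingFrechet μ ν) x (Iic q)) ∨
      ∀ q : ℚ, condLaw (hoeffdingFrechet μ ν) x (Iic q) ≤ condLaw (MQ μ ν Q) x (Iic q) := by
  have hM := MQ_isCoupling hQ
  have hp : IsProbabilityMeasure (MQ μ ν Q) := hM.isProbabilityMeasure
  simp_rw [condLaw_eq]
  have hle : ∀ (N N' : Measure (ℝ × ℝ)) [IsFiniteMeasure N] [IsFiniteMeasure N'] (A : Set ℝ),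
      MeasurableSet A → N.fst = μ → N'.fst = μ →
      (∀ S, MeasurableSet S → S ⊆ A → ∀ t, N (S ×ˢ Iic t) ≤ N' (S ×ˢ Iic t)) →
      ∀ᵐ x ∂μ, x ∈ A → ∀ q : ℚ, N.condKernel x (Iic q) ≤ N'.condKernel x (Iic q) := by
    intro N N' _ _ A hA h1 h2 h
    rw [← ae_restrict_iff' hA, ae_all_iff]
    intro q
    refine ae_le_of_forall_setLIntegral_le_of_sigmaFinite
      (N.condKernel.measurable_coe measurableSet_Iic) fun S hS _ => ?_
    rw [Measure.restrict_restrict hS]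
    have hSA := hS.inter hA
    have e1 := Measure.setLIntegral_condKernel_eq_measure_prod (ρ := N) hSA
      (measurableSet_Iic (a := (q : ℝ)))
    have e2 := Measure.setLIntegral_condKernel_eq_measure_prod (ρ := N') hSA
      (measurableSet_Iic (a := (q : ℝ)))
    rw [h1] at e1
    rw [h2] at e2
    rw [e1, e2]
    exact h _ hSA inter_subset_right _
  have a1 := hle (MQ μ ν Q) (hoeffdingFrechet μ ν) G hGm hM.1 hoeffdingFrechet_fst
    fun S hS hSG t => MQ_prod_Iic_le hQ hG hS hSG t
  have a2 := hle (hoeffdingFrechet μ ν) (MQ μ ν Q) Gᶜ hGm.compl hoeffdingFrechet_fst hM.1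
    fun S hS hSG t => prod_Iic_le_MQ hQ hG hS hSG t
  filter_upwards [a1, a2] with x h1 h2
  by_cases hx : x ∈ G
  · exact Or.inl (h1 hx)
  · exact Or.inr (h2 hx)

end MQProperties

/-! ### Barycentric lower bound for `AW1` and its attainment. -/

section Wasserstein

lemma edist_integral_le_W1 {p q : Measure ℝ} (hp : FiniteFirstMoment p)
    (hq : FiniteFirstMoment q) : edist (∫ y, y ∂p) (∫ y, y ∂q) ≤ W1 p q := by
  refine le_iInf₂ fun γ hγ => ?_
  have e1 : ∫ y, y ∂p = ∫ z, z.1 ∂γ := by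
    rw [← hγ.1, Measure.fst, integral_map measurable_fst.aemeasurable (by fun_prop)]
  have e2 : ∫ y, y ∂q = ∫ z, z.2 ∂γ := by
    rw [← hγ.2, Measure.snd, integral_map measurable_snd.aemeasurable (by fun_prop)]
  rw [e1, e2, edist_eq_enorm_sub, ← integral_sub (hγ.integrable_fst hp) (hγ.integrable_snd hq)]
  refine (enorm_integral_le_lintegral_enorm _).trans (le_of_eq ?_)
  simp_rw [edist_eq_enorm_sub]

lemma quantile_le_quantile {p q : Measure ℝ} [IsProbabilityMeasure p] [IsProbabilityMeasure q]
    (h : ∀ r : ℚ, p (Iic (r : ℝ)) ≤ q (Iic (r : ℝ))) {u : ℝ} (hu : u ∈ Ioo (0 : ℝ) 1) :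
    quantile q u ≤ quantile p u := by
  have hcdf : ∀ t, cdf p t ≤ cdf q t := by
    intro t
    rw [← (cdf q).iInf_rat_gt_eq t]
    have : Nonempty {r' : ℚ // t < r'} := let ⟨r, hr⟩ := exists_rat_gt t; ⟨⟨r, hr⟩⟩
    refine le_ciInf fun r => (monotone_cdf p r.2.le).trans ?_
    rw [cdf_eq_real, cdf_eq_real]
    exact ENNReal.toReal_mono (measure_ne_top _ _) (h r)
  exact (quantile_le_iff q hu _).2 (((quantile_le_iff p hu _).1 le_rfl).trans (hcdf _))

/-- For ordered laws the quantile difference has a constant sign, so the cost of the comonotone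
coupling is the distance between the means. -/
lemma W1_le_of_quantile_le {p q : Measure ℝ} [IsProbabilityMeasure p] [IsProbabilityMeasure q]
    (hp : FiniteFirstMoment p) (hq : FiniteFirstMoment q)
    (h : (∀ r : ℚ, p (Iic (r : ℝ)) ≤ q (Iic (r : ℝ))) ∨
      ∀ r : ℚ, q (Iic (r : ℝ)) ≤ p (Iic (r : ℝ))) :
    W1 p q ≤ edist (∫ y, y ∂p) (∫ y, y ∂q) := by
  have key : ∀ p q : Measure ℝ, IsProbabilityMeasure p → IsProbabilityMeasure q →
      FiniteFirstMoment p → FiniteFirstMoment q → (∀ r : ℚ, p (Iic (r : ℝ)) ≤ q (Iic (r : ℝ))) →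
      ∫⁻ u, edist (quantile p u) (quantile q u) ∂unitLebesgue
        ≤ edist (∫ y, y ∂p) (∫ y, y ∂q) := by
    intro p q _ _ hp hq h
    have hle : ∀ᵐ u ∂unitLebesgue, 0 ≤ quantile p u - quantile q u := by
      filter_upwards [ae_mem_Ioo] with u hu
      exact sub_nonneg.2 (quantile_le_quantile h hu)
    have ip := integrable_quantile p hp
    have iq := integrable_quantile q hq
    calc ∫⁻ u, edist (quantile p u) (quantile q u) ∂unitLebesgue
        = ∫⁻ u, ENNReal.ofReal (quantile p u - quantile q u) ∂unitLebesgue := by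
          refine lintegral_congr_ae (hle.mono fun u hu => ?_)
          dsimp only
          rw [edist_dist, Real.dist_eq, abs_of_nonneg hu]
      _ = ENNReal.ofReal (∫ y, y ∂p - ∫ y, y ∂q) := by
          rw [← integral_quantile p (fun x => x) measurable_id,
            ← integral_quantile q (fun x => x) measurable_id, ← integral_sub ip iq]
          exact (ofReal_integral_eq_lintegral_ofReal (ip.sub iq) hle).symm
      _ ≤ edist (∫ y, y ∂p) (∫ y, y ∂q) := by
          rw [edist_dist, Real.dist_eq]
          exact ENNReal.ofReal_le_ofReal (le_abs_self _)
  have hW : W1 p q ≤ ∫⁻ u, edist (quantile p u) (quantile q u) ∂unitLebesgue := by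
    refine (iInf₂_le (hoeffdingFrechet p q) ⟨hoeffdingFrechet_fst, hoeffdingFrechet_snd⟩).trans ?_
    rw [lintegral_hoeffdingFrechet (by fun_prop)]
  rcases h with h | h
  · exact hW.trans (key p q ‹_› ‹_› hp hq h)
  · refine hW.trans ?_
    rw [edist_comm]
    simp_rw [edist_comm (quantile p _)]
    exact key q p ‹_› ‹_› hq hp h

variable {μ ν : Measure ℝ} [IsProbabilityMeasure μ]

lemma ae_finiteFirstMoment_condLaw {π : Measure (ℝ × ℝ)} (h : IsCoupling μ ν π)
    (hν : FiniteFirstMoment ν) : ∀ᵐ x ∂μ, FiniteFirstMoment (condLaw π x) := by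
  have hp : IsProbabilityMeasure π := h.isProbabilityMeasure
  have := (h.integrable_snd hν).condKernel_ae
  rw [h.1] at this
  simp_rw [condLaw_eq]
  exact this

/-- The lower bound of the adapted distance from `π` to the martingale couplings. -/
noncomputable def barycenterCost (μ : Measure ℝ) (π : Measure (ℝ × ℝ)) : ℝ≥0∞ :=
  ∫⁻ x, edist x (∫ y, y ∂condLaw π x) ∂μ

/-- With `m` the mean of `π_x`, `|x - m| ≤ |x - x'| + |x' - m|`; since `x'` is the mean of `M_{x'}`,
the last term is at most `W1` of the two kernels. -/
lemma barycenterCost_le_AW1 {π M : Measure (ℝ × ℝ)} (hν : FiniteFirstMoment ν)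
    (hπ : IsCoupling μ ν π) (hM : IsMartingaleCoupling μ ν M) :
    barycenterCost μ π ≤ AW1 π M := by
  refine le_iInf₂ fun χ hχ => ?_
  rw [hπ.1, hM.1.1] at hχ
  have h1 := ae_finiteFirstMoment_condLaw hπ hν
  have h2 := (ae_finiteFirstMoment_condLaw hM.1 hν).and hM.2
  rw [← hχ.1] at h1
  rw [← hχ.2] at h2
  have h1' := ae_of_ae_map measurable_fst.aemeasurable h1
  have h2' := ae_of_ae_map measurable_snd.aemeasurable h2
  rw [barycenterCost]
  calc ∫⁻ x, edist x (∫ y, y ∂condLaw π x) ∂μ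
      ≤ ∫⁻ z, edist z.1 (∫ y, y ∂condLaw π z.1) ∂χ := by
        conv_lhs => rw [← hχ.1]
        exact lintegral_map_le _ _
    _ ≤ _ := by
        refine lintegral_mono_ae ?_
        filter_upwards [h1', h2'] with z hz1 hz2
        refine (edist_triangle z.1 z.2 _).trans ?_
        gcongr
        have := edist_integral_le_W1 hz1 hz2.1
        rwa [hz2.2, edist_comm] at this

/-- The diagonal coupling of `μ` has no displacement cost, and ordered kernels cost exactly the
distance between their means. -/
lemma AW1_le_barycenterCost {π M : Measure (ℝ × ℝ)} (hν : FiniteFirstMoment ν)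
    (hπ : IsCoupling μ ν π) (hM : IsMartingaleCoupling μ ν M)
    (h : ∀ᵐ x ∂μ, (∀ q : ℚ, condLaw M x (Iic q) ≤ condLaw π x (Iic q)) ∨
      ∀ q : ℚ, condLaw π x (Iic q) ≤ condLaw M x (Iic q)) :
    AW1 π M ≤ barycenterCost μ π := by
  have hp : IsProbabilityMeasure π := hπ.isProbabilityMeasure
  have hp' : IsProbabilityMeasure M := hM.1.isProbabilityMeasure
  have hχ : IsCoupling π.fst M.fst (μ.map fun x => (x, x)) := by
    rw [hπ.1, hM.1.1]
    exact ⟨by rw [Measure.fst_map_prodMk measurable_id', Measure.map_id'],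
      by rw [Measure.snd_map_prodMk measurable_id', Measure.map_id']⟩
  refine (iInf₂_le _ hχ).trans ((lintegral_map_le _ _).trans (lintegral_mono_ae ?_))
  filter_upwards [h, ae_finiteFirstMoment_condLaw hπ hν, ae_finiteFirstMoment_condLaw hM.1 hν,
    hM.2] with x hx h1 h2 h3
  have i1 : IsProbabilityMeasure (condLaw π x) := by rw [condLaw_eq]; infer_instance
  have i2 : IsProbabilityMeasure (condLaw M x) := by rw [condLaw_eq]; infer_instance
  have := W1_le_of_quantile_le h1 h2 hx.symm
  rw [h3, edist_comm] at this
  simpa using this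

end Wasserstein

end MartRearr

theorem mainTheorem3 (μ ν : MeasureTheory.Measure ℝ)
    [MeasureTheory.IsProbabilityMeasure μ] [MeasureTheory.IsProbabilityMeasure ν]
    (hμ : MartRearr.FiniteFirstMoment μ) (hν : MartRearr.FiniteFirstMoment ν)
    (hcx : MartRearr.ConvexOrder μ ν) :
    ∃ Q ∈ MartRearr.QSet μ ν,
      MartRearr.IsMartingaleRearrangement μ ν (MartRearr.hoeffdingFrechet μ ν)
        (MartRearr.MQ μ ν Q) ∧
      (MartRearr.SignConstantOnJumps μ ν → MartRearr.MQ μ ν Q = MartRearr.MIT μ ν) := by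
  obtain ⟨Q, hQ, hG, hIT⟩ := MartRearr.exists_mem_QSet hμ hν hcx
  have hM := MartRearr.MQ_isMartingaleCoupling hμ hν hQ
  have hHF : MartRearr.IsCoupling μ ν (MartRearr.hoeffdingFrechet μ ν) :=
    ⟨MartRearr.hoeffdingFrechet_fst, MartRearr.hoeffdingFrechet_snd⟩
  have hle := MartRearr.AW1_le_barycenterCost hν hHF hM
    (MartRearr.ae_condLaw_Iic_le hQ (MartRearr.measurableSet_plusSet μ ν) hG)
  exact ⟨Q, hQ, ⟨hM, le_antisymm
    (le_iInf₂ fun M' hM' => hle.trans (MartRearr.barycenterCost_le_AW1 hν hHF hM'))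
    (iInf₂_le _ hM)⟩, hIT⟩
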